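/- Let $T=p\,D_z^2+q\,D_z+r$ be a differential operator whose coefficients $p\neq 0$, $q$, $r$ are real rational functions, let $K\subset\mathbb N=\{0,1,2,\dots\}$ be a finite set with $m=|K|$ elements, and let $y_k$ ($k\in\mathbb N\setminus K$) be real polynomials with $\deg y_k=k$. Suppose that they form a Sturm--Liouville orthogonal polynomial system (SL-OPS) on a non-empty open interval $I\subset\mathbb R$ (bounded or unbounded), that is: (i) for every $k\notin K$ there is $\lambda_k$ with $T[y_k]=\lambda_k y_k$, and for $k\in K$ no polynomial of degree $k$ is an eigenfunction of $T$; (ii) the weight $W(z)=\frac1{p(z)}\exp\left(\int^z\frac{q(x)}{p(x)}\,dx\right)$ (determined up to a multiplicative constant; that is, $W'/W=(q-p')/p$) is single valued and positive on $I$; $\int_I |z|^jW(z)\,dz<\infty$ for all $j\in\mathbb N$; and $f(z)p(z)W(z)\to0$ at both endpoints of $I$ for every polynomial $f$; (iii) the span of $\{y_k : k\notin K\}$ is dense in $L^2(I,W(z)\,dz)$. Then $p$ is a polynomial of degree at most $2$, and there exist a real polynomial $s$ of degree at most $1$, a real polynomial $\eta$ of degree exactly $m$ without zeros on $I$, and a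 function $W_{\mathrm B}$ on $I$ such that $$W(z)=\frac{W_{\mathrm B}(z)}{\eta(z)^2}\quad(z\in I),\qquad W_{\mathrm B}(z)=\exp\left(\int^z\frac{s(x)}{p(x)}\,dx\right),$$ where $p$ has no zeros on $I$ and $W_{\mathrm B}$ is the weight on $I$ of a classical orthogonal polynomial system: up to a positive constant factor and an affine change of variable, $(I,W_{\mathrm B})$ is one of $\big(\mathbb R,\ e^{-t^2}\big)$, $\big((0,\infty),\ t^\alpha e^{-t}\big)$ with $\alpha>-1$, or $\big((-1,1),\ (1-t)^\alpha(1+t)^\beta\big)$ with $\alpha,\beta>-1$. -/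

import Mathlib

open Polynomial Filter Topology MeasureTheory

noncomputable section

namespace SLOPS

/-- The derivative `D_z f` of a real rational function, by the quotient rule. -/
def ratDeriv (f : RatFunc ℝ) : RatFunc ℝ :=
  (algebraMap ℝ[X] (RatFunc ℝ) (derivative f.num) * algebraMap ℝ[X] (RatFunc ℝ) f.denom
      - algebraMap ℝ[X] (RatFunc ℝ) f.num * algebraMap ℝ[X] (RatFunc ℝ) (derivative f.denom))
    / (algebraMap ℝ[X] (RatFunc ℝ) f.denom) ^ 2

/-- A second-order differential operator `T = p D² + q D + r` whose coefficients are real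
rational functions, with `p ≠ 0`. -/
structure DiffOp₂ where
  p : RatFunc ℝ
  q : RatFunc ℝ
  r : RatFunc ℝ
  p_ne_zero : p ≠ 0

/-- The action `T[y] = p y'' + q y' + r y` on a polynomial `y`; the result is a rational
function. -/
def DiffOp₂.app (T : DiffOp₂) (y : ℝ[X]) : RatFunc ℝ :=
  T.p * algebraMap ℝ[X] (RatFunc ℝ) (derivative (derivative y))
    + T.q * algebraMap ℝ[X] (RatFunc ℝ) (derivative y)
    + T.r * algebraMap ℝ[X] (RatFunc ℝ) y

/-- `y` is an eigenpolynomial of `T` of degree exactly `k` (in particular `y ≠ 0`). -/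
def DiffOp₂.IsEigenpolynomial (T : DiffOp₂) (k : ℕ) (y : ℝ[X]) : Prop :=
  y.degree = (k : WithBot ℕ) ∧
    ∃ c : ℝ, T.app y = algebraMap ℝ[X] (RatFunc ℝ) (C c * y)

/-- The logarithmic derivative `q / p - p' / p` of the weight
`W = (1 / p) exp (∫ q / p)` of `T`. -/
def DiffOp₂.weightLogDeriv (T : DiffOp₂) : RatFunc ℝ :=
  (T.q - ratDeriv T.p) / T.p

/-- The open interval of `ℝ` with (possibly infinite) endpoints `a` and `b`. -/
def interval (a b : EReal) : Set ℝ := {x : ℝ | a < (x : EReal) ∧ (x : EReal) < b}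

/-- The filter on `ℝ` of `x` tending to `a` from the right (`atBot` if `a = ⊥`). -/
def atLeftEnd (a : EReal) : Filter ℝ := comap (fun x : ℝ => (x : EReal)) (𝓝[>] a)

/-- The filter on `ℝ` of `x` tending to `b` from the left (`atTop` if `b = ⊤`). -/
def atRightEnd (b : EReal) : Filter ℝ := comap (fun x : ℝ => (x : EReal)) (𝓝[<] b)

/-- `W` is a positive, single-valued branch on `I` of the weight `(1 / p) exp (∫ q / p)` of `T`
(which is determined up to a multiplicative constant): `W > 0`, and `W' / W = (q - p') / p`,
written with the denominator of the reduced fraction `(q - p') / p` cleared. -/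
def DiffOp₂.IsPositiveWeight (T : DiffOp₂) (I : Set ℝ) (W : ℝ → ℝ) : Prop :=
  ∀ x ∈ I, 0 < W x ∧ ∃ d : ℝ, HasDerivAt W d x ∧
    T.weightLogDeriv.denom.eval x * d = T.weightLogDeriv.num.eval x * W x

/-- The measure `W(z) dz` on `I`. -/
def weightMeasure (I : Set ℝ) (W : ℝ → ℝ) : Measure ℝ :=
  (volume.restrict I).withDensity (fun x => ENNReal.ofReal (W x))

/-- The polynomials `y k`, `k ∉ K`, form a Sturm-Liouville orthogonal polynomial system with
finite set `K` of exceptional degrees, operator `T`, (non-empty, open) interval `(a, b)` and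
weight `W`. -/
structure IsSLOPS (K : Finset ℕ) (y : ℕ → ℝ[X]) (T : DiffOp₂) (a b : EReal) (W : ℝ → ℝ) :
    Prop where
  eigen : ∀ k, k ∉ K → T.IsEigenpolynomial k (y k)
  no_eigen : ∀ k ∈ K, ¬ ∃ f : ℝ[X], T.IsEigenpolynomial k f
  lt : a < b
  weight : T.IsPositiveWeight (interval a b) W
  moments : ∀ j : ℕ, IntegrableOn (fun x => x ^ j * W x) (interval a b)
  left_end : ∀ f : ℝ[X],
    Tendsto (fun x => f.eval x * T.p.eval (RingHom.id ℝ) x * W x) (atLeftEnd a) (𝓝 0)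
  right_end : ∀ f : ℝ[X],
    Tendsto (fun x => f.eval x * T.p.eval (RingHom.id ℝ) x * W x) (atRightEnd b) (𝓝 0)
  dense : ∀ g : ℝ → ℝ, MemLp g 2 (weightMeasure (interval a b) W) → ∀ ε : ENNReal, 0 < ε →
    ∃ f ∈ Submodule.span ℝ {f : ℝ[X] | ∃ k, k ∉ K ∧ f = y k},
      eLpNorm (fun x => g x - f.eval x) 2 (weightMeasure (interval a b) W) < ε

/-- `w` is `exp (∫ s / p)` on `I`, where the polynomial `p` has no zeros on `I`. -/
def IsExpIntegral (s p : ℝ[X]) (I : Set ℝ) (w : ℝ → ℝ) : Prop :=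
  ∃ F : ℝ → ℝ, ∀ x ∈ I,
    p.eval x ≠ 0 ∧ HasDerivAt F (s.eval x / p.eval x) x ∧ w x = Real.exp (F x)

/-- `w` on `I` is the weight of a classical orthogonal polynomial system: up to a positive
factor and an affine change `t = μ x + ν` of the variable, it is the Hermite weight `e^{-t²}` on
`ℝ`, the Laguerre weight `t^α e^{-t}` on `(0, ∞)` with `α > -1`, or the Jacobi weight
`(1 - t)^α (1 + t)^β` on `(-1, 1)` with `α, β > -1`. -/
def IsClassicalWeight (I : Set ℝ) (w : ℝ → ℝ) : Prop :=
  ∃ c μ ν : ℝ, 0 < c ∧ μ ≠ 0 ∧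
    ((I = Set.univ ∧ ∀ x ∈ I, w x = c * Real.exp (-(μ * x + ν) ^ 2)) ∨
     (∃ α : ℝ, -1 < α ∧ I = {x | 0 < μ * x + ν} ∧
        ∀ x ∈ I, w x = c * ((μ * x + ν) ^ α * Real.exp (-(μ * x + ν)))) ∨
     (∃ α β : ℝ, -1 < α ∧ -1 < β ∧ I = {x | -1 < μ * x + ν ∧ μ * x + ν < 1} ∧
        ∀ x ∈ I, w x = c * ((1 - (μ * x + ν)) ^ α * (1 + (μ * x + ν)) ^ β)))

end SLOPS

end

/-! Clear denominators, `T = (P D² + Q D + R) / E`, and let `U` be the complex span of the `y k`. It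
is `T`-invariant and, by its degrees, has codimension `m = K.card`. At each `ξ ∈ ℂ` only finitely
many integers, say `ν_ξ`, fail to be the order of vanishing at `ξ` of an element of `U`.

Local analysis (`local_structure`): on a function of order `k` at `ξ`, `T` multiplies the leading
coefficient, up to a nonzero constant, by a quadratic `χ(k)` and lowers the order by a fixed `t`. If
`t ≥ 2`, the least order in each residue class mod `t` cannot be lowered, so it is a root of `χ`.
Two roots leave only `t = 2`; the orders are then `a, a + 2, …` and `b, b + 2, …` with `a` even and
`b` odd, so `a + b - 1 = 2 ν_ξ`. By Vieta, `q` has at most a simple pole at `ξ`, with residue `-2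
ν_ξ p(ξ)`; `p` has no pole. Hence for `η = ∏ (z - ξ) ^ ν_ξ` the function `t = q + 2 p η' / η` is a
polynomial. Behaviour at infinity gives `deg p ≤ 2` and `deg t ≤ 1`. With `s = t - p'` this reads
`W' / W = s / p - 2 η' / η`, so `w = W η²` solves `p w' = s w`.

Degree of `η`: the polynomials satisfying every local condition of `U` have codimension `∑ ν_ξ`, by
the Chinese remainder theorem (`finrank_quotient_eq_sum`), so it remains to see that they all lie in
`U`. They form an invariant space (`localClosure_invariant`). An extra element would produce either
an eigenpolynomial with degree in `K` or a Jordan block (`le_span_of_invariant`). The latter is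
impossible because `T` is symmetric for `W`: `T f = c f + g`, `T g = c g` give `(p W (f' g - f g'))'
= W g² ≥ 0`, while the function differentiated vanishes at both endpoints
(`IsSLOPS.eq_zero_of_jordan`).

Classification: for `p w' = s w`, the boundary condition makes finite endpoints zeros of `p`, and
finite moments make `s / p` sufficiently negative at infinite endpoints. This fixes `p` up to a
constant on a line, half-line or bounded interval. So `p`, and then `η`, has no zero on `I`; `w` is
found by integration, and the boundary condition gives exponents `> -1`. -/

noncomputable section

namespace SLOPS

/-! ### Indicial polynomials and orders of vanishing of an invariant space. -/

section Algebra

variable {F : Type*} [Field F]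

/-- The operator `P f'' + Q f' + R f` with polynomial coefficients. -/
def polyOp (P Q R : F[X]) (f : F[X]) : F[X] :=
  P * derivative (derivative f) + Q * derivative f + R * f

theorem polyOp_sub (P Q R f g : F[X]) :
    polyOp P Q R (f - g) = polyOp P Q R f - polyOp P Q R g := by
  simp only [polyOp, derivative_sub]; ring

theorem polyOp_add (P Q R f g : F[X]) :
    polyOp P Q R (f + g) = polyOp P Q R f + polyOp P Q R g := by
  simp only [polyOp, derivative_add]; ring

theorem polyOp_C_mul (P Q R f : F[X]) (c : F) :
    polyOp P Q R (C c * f) = C c * polyOp P Q R f := by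
  simp only [polyOp, derivative_C_mul]; ring

/-- The orders of vanishing at `ξ` of the non-zero elements of `U`. -/
def orders (U : Submodule F F[X]) (ξ : F) : Set ℕ :=
  {k | ∃ g : F[X], g.eval ξ ≠ 0 ∧ (X - C ξ) ^ k * g ∈ U}

/-- The number of non-negative integers which are not an order of vanishing at `ξ`. -/
def gapCount (U : Submodule F F[X]) (ξ : F) : ℕ := (orders U ξ)ᶜ.ncard

theorem exists_eq_pow_mul_eval_ne_zero {f : F[X]} (hf : f ≠ 0) (ξ : F) :
    ∃ (k : ℕ) (g : F[X]), f = (X - C ξ) ^ k * g ∧ g.eval ξ ≠ 0 := by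
  obtain ⟨g, hg, h⟩ := exists_eq_pow_rootMultiplicity_mul_and_not_dvd f hf ξ
  exact ⟨_, g, hg, fun h' => h (dvd_iff_isRoot.2 h')⟩

theorem pow_mul_inj {ξ : F} {j k : ℕ} {f g : F[X]} (hf : f.eval ξ ≠ 0) (hg : g.eval ξ ≠ 0)
    (h : (X - C ξ) ^ j * f = (X - C ξ) ^ k * g) : j = k := by
  have hx : (X - C ξ : F[X]) ≠ 0 := X_sub_C_ne_zero ξ
  wlog hjk : j ≤ k generalizing j k f g
  · exact (this hg hf h.symm (by omega)).symm
  obtain ⟨i, rfl⟩ := Nat.exists_eq_add_of_le hjk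
  rw [pow_add, mul_assoc] at h
  have h2 := mul_left_cancel₀ (pow_ne_zero j hx) h
  rcases i with _ | i
  · rfl
  · rw [h2] at hf
    simp at hf

theorem coeff_taylor_pow_mul (ξ : F) (k : ℕ) (g : F[X]) :
    (taylor ξ ((X - C ξ) ^ k * g)).coeff k = g.eval ξ := by
  rw [taylor_mul, taylor_pow]
  simp [coeff_X_pow_mul']

/-- The quadratic polynomial governing the action of a second-order operator on the leading
coefficient at a point. -/
def indicial (α β γ : F) (k : ℕ) : F := α * (k * (k - 1)) + β * k + γ

/-- A quadratic polynomial with three distinct roots is zero. Divided differences avoid any case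
distinction on its degree. -/
theorem indicial_three [CharZero F] {α β γ : F} {i j k : ℕ} (hij : i ≠ j) (hik : i ≠ k)
    (hjk : j ≠ k) (hi : indicial α β γ i = 0) (hj : indicial α β γ j = 0)
    (hk : indicial α β γ k = 0) : α = 0 ∧ β = 0 ∧ γ = 0 := by
  unfold indicial at *
  have hij' : (i : F) - j ≠ 0 := sub_ne_zero.2 (Nat.cast_injective.ne hij)
  have hik' : (i : F) - k ≠ 0 := sub_ne_zero.2 (Nat.cast_injective.ne hik)
  have hjk' : (j : F) - k ≠ 0 := sub_ne_zero.2 (Nat.cast_injective.ne hjk)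
  have e1 : α * (i + j - 1) + β = 0 := by
    apply mul_left_cancel₀ hij'; linear_combination hi - hj
  have e2 : α * (i + k - 1) + β = 0 := by
    apply mul_left_cancel₀ hik'; linear_combination hi - hk
  have hα : α = 0 := by
    apply mul_left_cancel₀ hjk'; linear_combination e1 - e2
  have hβ : β = 0 := by simpa [hα] using e1
  exact ⟨hα, hβ, by simpa [hα, hβ] using hi⟩

/-- Vieta's formula for the sum of the roots, free of division so that `α = 0` is allowed. -/
theorem indicial_two [CharZero F] {α β γ : F} {i j : ℕ} (hij : i ≠ j)
    (hi : indicial α β γ i = 0) (hj : indicial α β γ j = 0) :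
    α * (i + j - 1) + β = 0 := by
  unfold indicial at *
  have hij' : (i : F) - j ≠ 0 := sub_ne_zero.2 (Nat.cast_injective.ne hij)
  apply mul_left_cancel₀ hij'; linear_combination hi - hj

/-- A cofinite set of integers stable under subtraction of `t`, except at some points, contains
one of the exceptional points in every class modulo `t`. -/
theorem exists_min_in_class {S : Set ℕ} (hS : Sᶜ.Finite) {t : ℕ} (ht : 0 < t)
    {Z : ℕ → Prop} (h : ∀ k ∈ S, ¬ Z k → ∃ j ∈ S, k = t + j) (i : ℕ) (hi : i < t) :
    ∃ n ∈ S, n % t = i ∧ Z n := by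
  have hex : ∃ n, n ∈ S ∧ n % t = i := by
    obtain ⟨M, hM⟩ := hS.bddAbove
    -- This lies beyond every exceptional integer, because `M` bounds the complement of `S`.
    refine ⟨i + t * (M + 1), ?_, ?_⟩
    · by_contra hc
      have := hM hc
      nlinarith
    · rw [Nat.add_mul_mod_self_left, Nat.mod_eq_of_lt hi]
  classical
  refine ⟨Nat.find hex, (Nat.find_spec hex).1, (Nat.find_spec hex).2, ?_⟩
  by_contra hZ
  obtain ⟨j, hj, e⟩ := h _ (Nat.find_spec hex).1 hZ
  refine Nat.find_min hex (m := j) (by omega) ⟨hj, ?_⟩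
  have := (Nat.find_spec hex).2
  rw [e] at this
  simpa using this

/-- There are `a / 2` even gaps and `(b - 1) / 2` odd ones. This turns the sum of the two exponents
into a gap count. -/
theorem ncard_gaps_of_two_classes {S : Set ℕ} {a b : ℕ} (ha : a % 2 = 0) (hb : b % 2 = 1)
    (hS : ∀ k, k ∈ S ↔ (k % 2 = 0 ∧ a ≤ k) ∨ (k % 2 = 1 ∧ b ≤ k)) :
    2 * Sᶜ.ncard + 1 = a + b := by
  have : Sᶜ = ((Finset.range (a / 2)).image (fun i => 2 * i) ∪
      (Finset.range (b / 2)).image (fun i => 2 * i + 1) : Finset ℕ) := by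
    ext k
    simp only [Set.mem_compl_iff, hS, Finset.coe_union, Finset.coe_image, Set.mem_union,
      Set.mem_image, Finset.coe_range, Set.mem_Iio]
    constructor
    · intro hk
      rcases Nat.mod_two_eq_zero_or_one k with h | h
      · exact Or.inl ⟨k / 2, by omega, by omega⟩
      · exact Or.inr ⟨k / 2, by omega, by omega⟩
    · rintro (⟨i, hi, rfl⟩ | ⟨i, hi, rfl⟩) <;> omega
  rw [this, Set.ncard_coe_finset, Finset.card_union_of_disjoint, Finset.card_image_of_injective,
    Finset.card_image_of_injective]
  · simp; omega
  · intro i j; simp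
  · intro i j; simp
  · rw [Finset.disjoint_left]
    simp only [Finset.mem_image]
    rintro k ⟨i, _, rfl⟩ ⟨j, _, h⟩
    omega

theorem X_sub_C_mul_derivative_pow_mul (ξ : F) (k : ℕ) (g : F[X]) :
    (X - C ξ) * derivative ((X - C ξ) ^ k * g) =
      (X - C ξ) ^ k * (C (k : F) * g + (X - C ξ) * derivative g) := by
  rcases k with _ | k
  · simp
  · simp only [derivative_mul, derivative_X_sub_C_pow]
    simp; ring

theorem X_sub_C_sq_mul_derivative_pow_mul (ξ : F) (k : ℕ) (g : F[X]) :
    (X - C ξ) ^ 2 * derivative (derivative ((X - C ξ) ^ k * g)) =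
      (X - C ξ) ^ k * (C ((k : F) * (k - 1)) * g + 2 * C (k : F) * ((X - C ξ) * derivative g) +
        (X - C ξ) ^ 2 * derivative (derivative g)) := by
  have h1 := X_sub_C_mul_derivative_pow_mul ξ k g
  have h2 := X_sub_C_mul_derivative_pow_mul ξ k (C (k : F) * g + (X - C ξ) * derivative g)
  rw [← h1] at h2
  have h3 : ∀ f : F[X], derivative ((X - C ξ) * f) = f + (X - C ξ) * derivative f := by
    intro f; simp
  rw [h3, mul_add, h1, derivative_add, h3, derivative_C_mul] at h2
  simp only [C_mul, C_sub, C_1]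
  linear_combination h2

/-- Action of a second-order operator on a function with a zero of order `k`. -/
theorem polyOp_pow_mul {P Q R A B Γ : F[X]} {ξ : F} {e : ℕ} (hP : P = (X - C ξ) ^ e * A)
    (hQ : (X - C ξ) * Q = (X - C ξ) ^ e * B) (hR : (X - C ξ) ^ 2 * R = (X - C ξ) ^ e * Γ)
    (k : ℕ) (g : F[X]) :
    ∃ h : F[X], (X - C ξ) ^ 2 * polyOp P Q R ((X - C ξ) ^ k * g) = (X - C ξ) ^ (k + e) * h ∧
      h.eval ξ = indicial (A.eval ξ) (B.eval ξ) (Γ.eval ξ) k * g.eval ξ := by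
  refine ⟨A * (C ((k : F) * (k - 1)) * g + 2 * C (k : F) * ((X - C ξ) * derivative g) +
        (X - C ξ) ^ 2 * derivative (derivative g)) +
        B * (C (k : F) * g + (X - C ξ) * derivative g) + Γ * g, ?_, ?_⟩
  · unfold polyOp
    have h1 := X_sub_C_mul_derivative_pow_mul ξ k g
    have h2 := X_sub_C_sq_mul_derivative_pow_mul ξ k g
    calc _ = P * ((X - C ξ) ^ 2 * derivative (derivative ((X - C ξ) ^ k * g))) +
          ((X - C ξ) * Q) * ((X - C ξ) * derivative ((X - C ξ) ^ k * g)) +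
          ((X - C ξ) ^ 2 * R) * ((X - C ξ) ^ k * g) := by ring
      _ = _ := by rw [h1, h2, hP, hQ, hR, pow_add]; ring
  · simp [indicial]; ring

/-- Largest power of `X - ξ` common to three polynomials. -/
theorem exists_common_pow {P Q R : F[X]} (hP : P ≠ 0) (ξ : F) :
    ∃ (e : ℕ) (A B Γ : F[X]), P = (X - C ξ) ^ e * A ∧ Q = (X - C ξ) ^ e * B ∧
      R = (X - C ξ) ^ e * Γ ∧ ¬ (A.eval ξ = 0 ∧ B.eval ξ = 0 ∧ Γ.eval ξ = 0) := by
  classical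
  obtain ⟨n, g, rfl, hg⟩ := exists_eq_pow_mul_eval_ne_zero hP ξ
  set p : ℕ → Prop := fun e => (X - C ξ) ^ e ∣ (X - C ξ) ^ n * g ∧ (X - C ξ) ^ e ∣ Q ∧
    (X - C ξ) ^ e ∣ R with hp
  have h0 : p 0 := by simp [hp]
  have hs : p (Nat.findGreatest p n) := Nat.findGreatest_spec (Nat.zero_le n) h0
  obtain ⟨⟨A, hA⟩, ⟨B, hB⟩, ⟨Γ, hΓ⟩⟩ := hs
  refine ⟨_, A, B, Γ, hA, hB, hΓ, ?_⟩
  rintro ⟨h1, h2, h3⟩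
  obtain ⟨A', rfl⟩ := dvd_iff_isRoot.2 h1
  obtain ⟨B', rfl⟩ := dvd_iff_isRoot.2 h2
  obtain ⟨Γ', rfl⟩ := dvd_iff_isRoot.2 h3
  have hs' : p (Nat.findGreatest p n + 1) :=
    ⟨⟨A', by rw [pow_succ, mul_assoc]; exact hA⟩, ⟨B', by rw [pow_succ, mul_assoc]; exact hB⟩,
      ⟨Γ', by rw [pow_succ, mul_assoc]; exact hΓ⟩⟩
  -- The search for a common exponent is bounded by the exact order `n` of `P`; going beyond it
  -- would make `g` vanish at `ξ`.
  have hle : Nat.findGreatest p n + 1 ≤ n := by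
    by_contra hc
    have hn : Nat.findGreatest p n = n := le_antisymm (Nat.findGreatest_le n) (by omega)
    rw [hn] at hA
    have := mul_left_cancel₀ (pow_ne_zero n (X_sub_C_ne_zero ξ)) hA
    rw [this] at hg; simp at hg
  have := Nat.le_findGreatest hle hs'
  omega

/-- The local structure at `ξ` of an operator `(P D² + Q D + R) / E` preserving a polynomial
space of finite codimension. -/
theorem local_structure [CharZero F] {P Q R E : F[X]} (hP : P ≠ 0) (hE : E ≠ 0)
    {U : Submodule F F[X]} (hU : ∀ f ∈ U, ∃ g ∈ U, E * g = polyOp P Q R f) (ξ : F)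
    (hfin : (orders U ξ)ᶜ.Finite) :
    ∃ (d : ℕ) (v A B Γ : F[X]), E = (X - C ξ) ^ d * v ∧ v.eval ξ ≠ 0 ∧
      P = (X - C ξ) ^ d * A ∧ (X - C ξ) * Q = (X - C ξ) ^ d * B ∧
      (X - C ξ) ^ 2 * R = (X - C ξ) ^ d * Γ ∧
      B.eval ξ = -2 * gapCount U ξ * A.eval ξ := by
  have hx : (X - C ξ : F[X]) ≠ 0 := X_sub_C_ne_zero ξ
  obtain ⟨d, v, hEv, hv⟩ := exists_eq_pow_mul_eval_ne_zero hE ξ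
  obtain ⟨e, A, B, Γ, hA, hB, hΓ, hne⟩ := exists_common_pow (Q := (X - C ξ) * Q)
    (R := (X - C ξ) ^ 2 * R) hP ξ
  -- Away from roots of the indicial polynomial, the image under `T` has order exactly `k + e - d -
  -- 2`, and it lies in `U` by invariance.
  have hstep : ∀ k ∈ orders U ξ, ¬ indicial (A.eval ξ) (B.eval ξ) (Γ.eval ξ) k = 0 →
      ∃ j ∈ orders U ξ, k + e = d + 2 + j := by
    rintro k ⟨g, hg, hgU⟩ hk
    obtain ⟨g₁, hg₁U, hg₁⟩ := hU _ hgU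
    obtain ⟨h, hh, hhe⟩ := polyOp_pow_mul hA hB hΓ k g
    have hh0 : h.eval ξ ≠ 0 := by rw [hhe]; exact mul_ne_zero hk hg
    have hg₁0 : g₁ ≠ 0 := by
      rintro rfl
      rw [← hg₁, mul_zero, mul_zero, eq_comm, mul_eq_zero] at hh
      rcases hh with hh | hh
      · exact pow_ne_zero _ hx hh
      · simp [hh] at hh0
    obtain ⟨j, w, rfl, hw⟩ := exists_eq_pow_mul_eval_ne_zero hg₁0 ξ
    refine ⟨j, ⟨w, hw, hg₁U⟩, pow_mul_inj hh0 (g := v * w) (by simp [hv, hw]) ?_⟩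
    rw [← hh, ← hg₁, hEv]; ring
  -- If `T` lowers orders by at most one, a factor `X - ξ` is left over in all three coefficients.
  -- Both sides of the residue relation then vanish.
  by_cases hed : d + 1 ≤ e
  · obtain ⟨i, rfl⟩ := Nat.exists_eq_add_of_le hed
    refine ⟨d, v, (X - C ξ) ^ (1 + i) * A, (X - C ξ) ^ (1 + i) * B, (X - C ξ) ^ (1 + i) * Γ,
      hEv, hv, ?_, ?_, ?_, ?_⟩
    · rw [hA]; ring
    · rw [hB]; ring
    · rw [hΓ]; ring
    · simp
  -- Otherwise orders drop by `2 + i`, and the least order in each class modulo `2 + i` is an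
  -- indicial root.
  · obtain ⟨i, hi⟩ : ∃ i, d + 2 = e + 2 + i := ⟨d - e, by omega⟩
    have hstep' : ∀ k ∈ orders U ξ, ¬ indicial (A.eval ξ) (B.eval ξ) (Γ.eval ξ) k = 0 →
        ∃ j ∈ orders U ξ, k = (2 + i) + j := by
      intro k hk hk'
      obtain ⟨j, hj, h⟩ := hstep k hk hk'
      exact ⟨j, hj, by omega⟩
    have hmin := exists_min_in_class hfin (by omega : 0 < 2 + i) hstep'
    obtain ⟨a, haS, ha, hχa⟩ := hmin 0 (by omega)
    obtain ⟨b, hbS, hb, hχb⟩ := hmin 1 (by omega)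
    rcases i with _ | i
    · obtain rfl : d = e := by omega
      have hab : a ≠ b := by rintro rfl; omega
      have hAB := indicial_two hab hχa hχb
      simp only [add_zero] at ha hb hstep'
      have hroot : ∀ k, indicial (A.eval ξ) (B.eval ξ) (Γ.eval ξ) k = 0 → k = a ∨ k = b := by
        intro k hk
        by_contra! hc
        exact hne (indicial_three hab hc.1.symm hc.2.symm hχa hχb hk)
      have hdown : ∀ k ∈ orders U ξ, k ≠ a → k ≠ b → ∃ j ∈ orders U ξ, k = 2 + j :=
        fun k hk h1 h2 => hstep' k hk fun h => (hroot k h).elim h1 h2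
      have hup : ∀ k, k ∉ orders U ξ → k + 2 ∉ orders U ξ ∨ k + 2 = a ∨ k + 2 = b := by
        intro k hk
        by_contra! hc
        obtain ⟨j, hj, h⟩ := hdown _ hc.1 hc.2.1 hc.2.2
        obtain rfl : k = j := by omega
        exact hk hj
      -- A missing term would make all later terms of the same parity missing, since only `a` and
      -- `b` may be orders without a predecessor. This contradicts finiteness of the gaps.
      have hchain : ∀ c, (c = a ∨ c = b) → ∀ j, c + 2 * j ∈ orders U ξ := by
        intro c hc j
        by_contra hj
        have : ∀ i, c + 2 * (j + i) ∉ orders U ξ := by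
          intro i
          induction i with
          | zero => exact hj
          | succ i ih =>
            rcases hup _ ih with h | h | h
            · exact h
            · rcases j with _ | j
              · rcases hc with rfl | rfl
                · exact absurd haS hj
                · exact absurd hbS hj
              · rcases hc with rfl | rfl <;> omega
            · rcases j with _ | j
              · rcases hc with rfl | rfl
                · exact absurd haS hj
                · exact absurd hbS hj
              · rcases hc with rfl | rfl <;> omega
        obtain ⟨M, hM⟩ := hfin.bddAbove
        have := hM (this (M + 1))
        omega
      have hlow : ∀ k ∈ orders U ξ, (k % 2 = 0 ∧ a ≤ k) ∨ (k % 2 = 1 ∧ b ≤ k) := by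
        intro k
        induction k using Nat.strong_induction_on with
        | _ k ih =>
          intro hk
          by_cases h1 : k = a
          · left; omega
          by_cases h2 : k = b
          · right; omega
          obtain ⟨j, hj, rfl⟩ := hdown k hk h1 h2
          have := ih j (by omega) hj
          omega
      have hcard := ncard_gaps_of_two_classes ha hb (S := orders U ξ) (fun k => ⟨hlow k, ?_⟩)
      · refine ⟨d, v, A, B, Γ, hEv, hv, hA, hB, hΓ, ?_⟩
        have : (2 * (gapCount U ξ : F) + 1) = a + b := by
          have := congrArg (Nat.cast : ℕ → F) hcard
          push_cast at this
          exact this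
        linear_combination hAB + A.eval ξ * this
      · rintro (⟨h1, h2⟩ | ⟨h1, h2⟩)
        · obtain ⟨j, rfl⟩ : ∃ j, k = a + 2 * j := ⟨(k - a) / 2, by omega⟩
          exact hchain a (Or.inl rfl) j
        · obtain ⟨j, rfl⟩ : ∃ j, k = b + 2 * j := ⟨(k - b) / 2, by omega⟩
          exact hchain b (Or.inr rfl) j
    -- A drop of three or more provides three residue classes, hence three roots of a nonzero
    -- quadratic.
    · obtain ⟨c, hcS, hc, hχc⟩ := hmin 2 (by omega)
      refine absurd (indicial_three ?_ ?_ ?_ hχa hχb hχc) hne <;> rintro rfl <;> omega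

/-! ### Codimension in terms of local gaps. -/

theorem exists_orders_coeff_taylor_ne_zero {U : Submodule F F[X]} {f : F[X]} (hf : f ∈ U)
    (h0 : f ≠ 0) (ξ : F) : ∃ k ∈ orders U ξ, (taylor ξ f).coeff k ≠ 0 := by
  obtain ⟨k, g, rfl, hg⟩ := exists_eq_pow_mul_eval_ne_zero h0 ξ
  exact ⟨k, ⟨g, hg, hf⟩, by rwa [coeff_taylor_pow_mul]⟩

/-- A nonzero combination of gap powers vanishes to an order which is itself a gap, so it cannot lie
in `U`. -/
theorem linearIndependent_gaps (U : Submodule F F[X]) (ξ : F) :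
    LinearIndependent F
      (fun k : ((orders U ξ)ᶜ : Set ℕ) => U.mkQ ((X - C ξ) ^ (k : ℕ))) := by
  rw [linearIndependent_iff']
  intro s c hc
  have hmem : ∑ i ∈ s, c i • (X - C ξ) ^ (i : ℕ) ∈ U := by
    rw [← Submodule.Quotient.mk_eq_zero, ← Submodule.mkQ_apply, map_sum]
    simpa using hc
  have hcoeff : ∀ k, (taylor ξ (∑ i ∈ s, c i • (X - C ξ) ^ (i : ℕ))).coeff k =
      ∑ i ∈ s, if k = i then c i else 0 := by
    intro k
    simp only [map_sum, map_smul, taylor_pow, map_sub, taylor_X, taylor_C, add_sub_cancel_right,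
      finsetSum_coeff, coeff_smul, coeff_X_pow, smul_eq_mul, mul_ite, mul_one, mul_zero]
  have hz : ∑ i ∈ s, c i • (X - C ξ) ^ (i : ℕ) = 0 := by
    by_contra h0
    obtain ⟨k, hk, hk'⟩ := exists_orders_coeff_taylor_ne_zero hmem h0 ξ
    rw [hcoeff] at hk'
    refine hk' (Finset.sum_eq_zero fun i _ => if_neg ?_)
    rintro rfl
    exact i.2 hk
  intro i hi
  have := hcoeff i
  rw [hz] at this
  simpa [Subtype.coe_inj, hi] using this.symm

theorem finite_gaps (U : Submodule F F[X]) [Module.Finite F (F[X] ⧸ U)] (ξ : F) :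
    (orders U ξ)ᶜ.Finite := by
  have := (linearIndependent_gaps U ξ).finite_of_isNoetherian
  exact Set.toFinite _

/-- The polynomials which agree to any order at `ξ` with an element of `U`. -/
def localClosure (U : Submodule F F[X]) (ξ : F) : Submodule F F[X] where
  carrier := {f | ∀ M : ℕ, ∃ u ∈ U, (X - C ξ) ^ M ∣ f - u}
  zero_mem' := fun M => ⟨0, U.zero_mem, by simp⟩
  add_mem' := by
    intro f g hf hg M
    obtain ⟨u, hu, h⟩ := hf M
    obtain ⟨w, hw, h'⟩ := hg M
    exact ⟨u + w, U.add_mem hu hw, by rw [add_sub_add_comm]; exact dvd_add h h'⟩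
  smul_mem' := by
    intro c f hf M
    obtain ⟨u, hu, h⟩ := hf M
    exact ⟨c • u, U.smul_mem c hu, by
      rw [← smul_sub, smul_eq_C_mul]; exact h.mul_left _⟩

theorem le_localClosure (U : Submodule F F[X]) (ξ : F) : U ≤ localClosure U ξ :=
  fun f hf _ => ⟨f, hf, by simp⟩

theorem orders_localClosure (U : Submodule F F[X]) (ξ : F) :
    orders (localClosure U ξ) ξ = orders U ξ := by
  ext k
  constructor
  · rintro ⟨g, hg, h⟩
    obtain ⟨u, hu, w, hw⟩ := h (k + 1)
    refine ⟨g - (X - C ξ) * w, by simpa using hg, ?_⟩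
    convert hu using 1
    linear_combination hw
  · rintro ⟨g, hg, h⟩
    exact ⟨g, hg, le_localClosure U ξ h⟩

theorem exists_improve {U : Submodule F F[X]} {ξ : F} {M : ℕ} (hM : M ∈ orders U ξ) (h : F[X]) :
    ∃ u ∈ U, (X - C ξ) ^ (M + 1) ∣ (X - C ξ) ^ M * h - u := by
  obtain ⟨g, hg, hgU⟩ := hM
  refine ⟨_, U.smul_mem (h.eval ξ / g.eval ξ) hgU, ?_⟩
  have : (X - C ξ) ∣ h - C (h.eval ξ / g.eval ξ) * g := by
    rw [dvd_iff_isRoot]; simp [hg]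
  obtain ⟨w, hw⟩ := this
  refine ⟨w, ?_⟩
  rw [smul_eq_C_mul, pow_succ]
  linear_combination (X - C ξ) ^ M * hw

/-- Every order from `N` on is available in `U`, so the Taylor coefficients at `ξ` can be matched
one after another. -/
theorem mem_localClosure_of_dvd {U : Submodule F F[X]} {ξ : F} {N : ℕ}
    (hN : ∀ k, N ≤ k → k ∈ orders U ξ) {f : F[X]} (hf : (X - C ξ) ^ N ∣ f) :
    f ∈ localClosure U ξ := by
  have key : ∀ i, ∃ u ∈ U, (X - C ξ) ^ (N + i) ∣ f - u := by
    intro i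
    induction i with
    | zero => exact ⟨0, U.zero_mem, by simpa using hf⟩
    | succ i ih =>
      obtain ⟨u, hu, h, hh⟩ := ih
      obtain ⟨w, hw, hd⟩ := exists_improve (hN (N + i) (by omega)) h
      refine ⟨u + w, U.add_mem hu hw, ?_⟩
      rw [← hh] at hd
      rwa [sub_sub] at hd
  intro M
  obtain ⟨u, hu, h⟩ := key M
  exact ⟨u, hu, (pow_dvd_pow _ (by omega)).trans h⟩

/-- Elimination of Taylor coefficients in increasing order: an attained order is removed by an
element of `U`, a gap by the corresponding power of `X - ξ`. This is the spanning half of the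
codimension count. -/
theorem exists_gap_approx (U : Submodule F F[X]) (ξ : F) (f : F[X]) (M : ℕ) :
    ∃ s ∈ Submodule.span F ((fun k => (X - C ξ) ^ k) '' (orders U ξ)ᶜ), ∃ u ∈ U,
      (X - C ξ) ^ M ∣ f - s - u := by
  induction M with
  | zero => exact ⟨0, Submodule.zero_mem _, 0, U.zero_mem, by simp⟩
  | succ M ih =>
    obtain ⟨s, hs, u, hu, h, hh⟩ := ih
    by_cases hM : M ∈ orders U ξ
    · obtain ⟨w, hw, hd⟩ := exists_improve hM h
      refine ⟨s, hs, u + w, U.add_mem hu hw, ?_⟩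
      rw [← hh] at hd
      convert hd using 1
      ring
    · refine ⟨s + h.eval ξ • (X - C ξ) ^ M, Submodule.add_mem _ hs (Submodule.smul_mem _ _
        (Submodule.subset_span ⟨M, hM, rfl⟩)), u, hu, ?_⟩
      obtain ⟨w, hw⟩ := (dvd_iff_isRoot (p := h - C (h.eval ξ)) (a := ξ)).2 (by simp)
      refine ⟨w, ?_⟩
      rw [smul_eq_C_mul, pow_succ]
      linear_combination hh + (X - C ξ) ^ M * hw

theorem exists_forall_ge_mem_orders {U : Submodule F F[X]} {ξ : F}
    (hfin : (orders U ξ)ᶜ.Finite) : ∃ N, ∀ k, N ≤ k → k ∈ orders U ξ := by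
  obtain ⟨M, hM⟩ := hfin.bddAbove
  refine ⟨M + 1, fun k hk => ?_⟩
  by_contra hc
  have := hM hc
  omega

theorem finrank_quotient_localClosure {U : Submodule F F[X]} {ξ : F}
    (hfin : (orders U ξ)ᶜ.Finite) :
    Module.Finite F (F[X] ⧸ localClosure U ξ) ∧
      Module.finrank F (F[X] ⧸ localClosure U ξ) = gapCount U ξ := by
  obtain ⟨N, hN⟩ := exists_forall_ge_mem_orders hfin
  have hli := linearIndependent_gaps (localClosure U ξ) ξ
  rw [orders_localClosure] at hli
  have hsp : ⊤ ≤ Submodule.span F (Set.range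
      (fun k : ((orders U ξ)ᶜ : Set ℕ) => (localClosure U ξ).mkQ ((X - C ξ) ^ (k : ℕ)))) := by
    rintro z -
    obtain ⟨f, rfl⟩ := Submodule.mkQ_surjective _ z
    obtain ⟨s, hs, u, hu, hd⟩ := exists_gap_approx U ξ f N
    have h1 : (localClosure U ξ).mkQ f = (localClosure U ξ).mkQ s := by
      rw [← sub_eq_zero, ← map_sub, Submodule.mkQ_apply, Submodule.Quotient.mk_eq_zero]
      have := Submodule.add_mem _ (mem_localClosure_of_dvd hN hd) (le_localClosure U ξ hu)
      simpa using this
    rw [h1]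
    have h2 := Submodule.mem_map_of_mem (f := (localClosure U ξ).mkQ) hs
    rw [Submodule.map_span, ← Set.image_comp] at h2
    rw [show Set.range (fun k : ((orders U ξ)ᶜ : Set ℕ) =>
      (localClosure U ξ).mkQ ((X - C ξ) ^ (k : ℕ))) =
        ((localClosure U ξ).mkQ ∘ fun k => (X - C ξ) ^ k) '' (orders U ξ)ᶜ by
      rw [Set.image_eq_range]; rfl]
    exact h2
  have := hfin.to_subtype
  let b := Module.Basis.mk hli hsp
  exact ⟨Module.Finite.of_basis b, by rw [Module.finrank_eq_nat_card_basis b]; rfl⟩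

/-- The codimension of a space of polynomials with prescribed degrees. -/
theorem finrank_quotient_of_degrees {U : Submodule F F[X]} {K : Finset ℕ}
    (h1 : ∀ f ∈ U, f ≠ 0 → f.natDegree ∉ K) (h2 : ∀ k, k ∉ K → ∃ f ∈ U, f.degree = k) :
    Module.Finite F (F[X] ⧸ U) ∧ Module.finrank F (F[X] ⧸ U) = K.card := by
  have hli : LinearIndependent F (fun k : K => U.mkQ ((X : F[X]) ^ (k : ℕ))) := by
    rw [Fintype.linearIndependent_iff]
    intro c hc
    have hmem : ∑ i, c i • (X : F[X]) ^ (i : ℕ) ∈ U := by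
      rw [← Submodule.Quotient.mk_eq_zero, ← Submodule.mkQ_apply, map_sum]
      simpa using hc
    have hcoeff : ∀ k, (∑ i, c i • (X : F[X]) ^ (i : ℕ)).coeff k =
        ∑ i : K, if k = i then c i else 0 := by
      intro k
      simp only [finsetSum_coeff, coeff_smul, coeff_X_pow, smul_eq_mul, mul_ite, mul_one,
        mul_zero]
    have hz : ∑ i, c i • (X : F[X]) ^ (i : ℕ) = 0 := by
      by_contra h0
      have h3 := h1 _ hmem h0
      have h4 := leadingCoeff_ne_zero.2 h0
      rw [leadingCoeff, hcoeff] at h4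
      refine h4 (Finset.sum_eq_zero fun i _ => if_neg ?_)
      intro h
      exact h3 (h ▸ i.2)
    intro i
    have := hcoeff i
    rw [hz] at this
    simpa [Subtype.coe_inj] using this.symm
  have hsp : ⊤ ≤ Submodule.span F (Set.range (fun k : K => U.mkQ ((X : F[X]) ^ (k : ℕ)))) := by
    set S := Submodule.span F (Set.range (fun k : K => U.mkQ ((X : F[X]) ^ (k : ℕ))))
    -- The leading term is removed by `X ^ n` when `n ∈ K`, and by an element of `U` otherwise.
    have key : ∀ n : ℕ, ∀ f : F[X], f.degree < n → U.mkQ f ∈ S := by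
      intro n
      induction n with
      | zero =>
        intro f hf
        have : f = 0 := by
          rw [← degree_eq_bot]
          simpa [Nat.WithBot.lt_zero_iff] using hf
        simp [this]
      | succ n ih =>
        intro f hf
        have hred : ∀ g : F[X], g.degree = n → U.mkQ g ∈ S → U.mkQ f ∈ S := by
          intro g hg hgS
          have hg0 : g.coeff n ≠ 0 := by
            have : g ≠ 0 := by rintro rfl; simp at hg
            rw [← natDegree_eq_of_degree_eq_some hg]
            exact leadingCoeff_ne_zero.2 this
          have h3 : (f - C (f.coeff n / g.coeff n) * g).degree < n := by
            rw [degree_lt_iff_coeff_zero]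
            intro m hm
            rcases hm.lt_or_eq with hm | rfl
            · rw [coeff_sub, coeff_C_mul, coeff_eq_zero_of_degree_lt (n := m) (p := g),
                coeff_eq_zero_of_degree_lt (n := m) (p := f)]
              · simp
              · exact hf.trans_le (by exact_mod_cast hm)
              · rw [hg]; exact_mod_cast hm
            · simp [hg0]
          have h4 := S.add_mem (ih _ h3) (S.smul_mem (f.coeff n / g.coeff n) hgS)
          rw [← map_smul, ← map_add, smul_eq_C_mul] at h4
          simpa using h4
        by_cases hn : n ∈ K
        · exact hred (X ^ n) (by simp) (Submodule.subset_span ⟨⟨n, hn⟩, rfl⟩)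
        · obtain ⟨g, hgU, hg⟩ := h2 n hn
          refine hred g hg ?_
          rw [Submodule.mkQ_apply, (Submodule.Quotient.mk_eq_zero U).2 hgU]
          exact S.zero_mem
    rintro z -
    obtain ⟨f, rfl⟩ := Submodule.mkQ_surjective _ z
    exact key (f.natDegree + 1) f (degree_le_natDegree.trans_lt (by exact_mod_cast Nat.lt_succ_self _))
  let b := Module.Basis.mk hli hsp
  exact ⟨Module.Finite.of_basis b, by simp [Module.finrank_eq_card_basis b]⟩

theorem localClosure_eq_top {U : Submodule F F[X]} {ξ : F} (hfin : (orders U ξ)ᶜ.Finite)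
    (h : gapCount U ξ = 0) : localClosure U ξ = ⊤ := by
  rw [gapCount, Set.ncard_eq_zero hfin, Set.compl_empty_iff] at h
  exact eq_top_iff.2 fun f _ => mem_localClosure_of_dvd (N := 0) (by simp [h]) (by simp)

/-- For a space of polynomials which is determined by local conditions, the codimension is the
sum of the numbers of local gaps. -/
theorem finrank_quotient_eq_sum {U : Submodule F F[X]} (hfin : ∀ ξ, (orders U ξ)ᶜ.Finite)
    (hU : ∀ f, (∀ ξ, f ∈ localClosure U ξ) → f ∈ U) (S : Finset F)
    (hS : ∀ ξ, ξ ∉ S → gapCount U ξ = 0) :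
    Module.finrank F (F[X] ⧸ U) = ∑ ξ ∈ S, gapCount U ξ := by
  let Φ : F[X] →ₗ[F] (∀ ξ : S, F[X] ⧸ localClosure U (ξ : F)) :=
    LinearMap.pi fun ξ => (localClosure U (ξ : F)).mkQ
  have hker : LinearMap.ker Φ = U := by
    ext f
    simp only [Φ, LinearMap.mem_ker]
    constructor
    · intro h
      refine hU f fun ξ => ?_
      by_cases hξ : ξ ∈ S
      · have := congrFun h ⟨ξ, hξ⟩
        simpa using this
      · rw [localClosure_eq_top (hfin ξ) (hS ξ hξ)]; trivial
    · intro h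
      ext ξ
      simpa using le_localClosure U ξ h
  choose N hN using fun ξ => exists_forall_ge_mem_orders (hfin ξ)
  -- Chinese remainder theorem: each local condition depends only on a residue modulo a power of `X
  -- - ξ`.
  have hsurj : Function.Surjective Φ := by
    intro z
    choose f hf using fun ξ => Submodule.mkQ_surjective _ (z ξ)
    have hco : Pairwise fun i j : S => IsCoprime (Ideal.span {(X - C (i : F)) ^ N i})
        (Ideal.span {(X - C (j : F)) ^ N j}) := by
      intro i j hij
      rw [Ideal.isCoprime_span_singleton_iff]
      exact (isCoprime_X_sub_C_of_isUnit_sub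
        (sub_ne_zero.2 (Subtype.coe_injective.ne hij)).isUnit).pow
    obtain ⟨r, hr⟩ := Ideal.exists_forall_sub_mem_ideal hco f
    refine ⟨r, funext fun ξ => ?_⟩
    rw [← hf ξ]
    simp only [Φ, LinearMap.pi_apply]
    rw [← sub_eq_zero, ← map_sub, Submodule.mkQ_apply, Submodule.Quotient.mk_eq_zero]
    exact mem_localClosure_of_dvd (hN ξ) (Ideal.mem_span_singleton.1 (hr ξ))
  have e := Φ.quotKerEquivOfSurjective hsurj
  rw [hker] at e
  have : ∀ ξ : S, Module.Finite F (F[X] ⧸ localClosure U (ξ : F)) :=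
    fun ξ => (finrank_quotient_localClosure (hfin ξ)).1
  rw [e.finrank_eq, Module.finrank_pi_fintype, ← Finset.sum_coe_sort S]
  exact Finset.sum_congr rfl fun ξ _ => (finrank_quotient_localClosure (hfin (ξ : F))).2

/-! ### Invariance of the space cut out by all local conditions. -/

theorem dvd_of_local [IsAlgClosed F] {E G : F[X]} (hE : E ≠ 0)
    (h : ∀ (ξ : F) (d : ℕ) (v : F[X]), E = (X - C ξ) ^ d * v → v.eval ξ ≠ 0 →
      (X - C ξ) ^ d ∣ G) : E ∣ G := by
  classical
  by_cases hG : G = 0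
  · simp [hG]
  rw [IsAlgClosed.dvd_iff_roots_le_roots hE hG, Multiset.le_iff_count]
  intro ξ
  rw [count_roots, count_roots, le_rootMultiplicity_iff hG]
  obtain ⟨v, hv, hv'⟩ := exists_eq_pow_rootMultiplicity_mul_and_not_dvd E hE ξ
  exact h ξ _ v hv fun h => hv' (dvd_iff_isRoot.2 h)

/-- An operator with the local structure of `local_structure` lowers the order of vanishing by at
most two. -/
theorem polyOp_dvd_of_dvd {P Q R A B Γ : F[X]} {ξ : F} {d : ℕ} (hP : P = (X - C ξ) ^ d * A)
    (hQ : (X - C ξ) * Q = (X - C ξ) ^ d * B) (hR : (X - C ξ) ^ 2 * R = (X - C ξ) ^ d * Γ)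
    {M : ℕ} {f : F[X]} (hf : (X - C ξ) ^ (M + 2) ∣ f) :
    (X - C ξ) ^ (d + M) ∣ polyOp P Q R f := by
  obtain ⟨g, rfl⟩ := hf
  obtain ⟨h, hh, -⟩ := polyOp_pow_mul hP hQ hR (M + 2) g
  refine ⟨h, mul_left_cancel₀ (pow_ne_zero 2 (X_sub_C_ne_zero ξ)) ?_⟩
  rw [hh]; ring

/-- The local closure of an invariant space is invariant. -/
theorem localClosure_invariant [IsAlgClosed F] [CharZero F] {P Q R E : F[X]} (hP : P ≠ 0)
    (hE : E ≠ 0) {U : Submodule F F[X]} (hU : ∀ f ∈ U, ∃ g ∈ U, E * g = polyOp P Q R f)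
    (hfin : ∀ ξ, (orders U ξ)ᶜ.Finite) {f : F[X]} (hf : ∀ ξ, f ∈ localClosure U ξ) :
    ∃ g, (∀ ξ, g ∈ localClosure U ξ) ∧ E * g = polyOp P Q R f := by
  -- Approximation of `f` to order `M + 2` by `u ∈ U` gives, after applying the operator,
  -- approximation to order `M` beyond the zero of `E`.
  have key : ∀ ξ M, ∃ (d : ℕ) (v w : F[X]), E = (X - C ξ) ^ d * v ∧ v.eval ξ ≠ 0 ∧ w ∈ U ∧
      (X - C ξ) ^ (d + M) ∣ polyOp P Q R f - E * w := by
    intro ξ M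
    obtain ⟨d, v, A, B, Γ, hEv, hv, hA, hB, hΓ, -⟩ := local_structure hP hE hU ξ (hfin ξ)
    obtain ⟨u, hu, hd⟩ := hf ξ (M + 2)
    obtain ⟨w, hw, hEw⟩ := hU u hu
    exact ⟨d, v, w, hEv, hv, hw, by
      rw [hEw, ← polyOp_sub]; exact polyOp_dvd_of_dvd hA hB hΓ hd⟩
  have hdvd : E ∣ polyOp P Q R f := by
    refine dvd_of_local hE fun ξ d v hEv hv => ?_
    obtain ⟨d', v', w, hEv', hv', -, hd⟩ := key ξ 0
    obtain rfl := pow_mul_inj hv hv' (hEv.symm.trans hEv')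
    have := dvd_add hd ((Dvd.intro _ hEv'.symm : (X - C ξ) ^ (d + 0) ∣ E).mul_right w)
    simpa using this
  obtain ⟨g, hg⟩ := hdvd
  refine ⟨g, fun ξ M => ?_, hg.symm⟩
  obtain ⟨d, v, w, hEv, hv, hw, hd⟩ := key ξ M
  refine ⟨w, hw, ?_⟩
  rw [hg, ← mul_sub, hEv, pow_add, mul_assoc] at hd
  have := (mul_dvd_mul_iff_left (pow_ne_zero d (X_sub_C_ne_zero ξ))).1 hd
  refine IsCoprime.dvd_of_dvd_mul_left (IsCoprime.pow_left ?_) this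
  rw [(prime_X_sub_C ξ).coprime_iff_not_dvd, dvd_iff_isRoot]
  exact hv

/-! ### Behaviour at infinity, and completeness of the eigenpolynomials in an invariant space. -/

theorem natDegree_not_mem_of_mem_span {K : Set ℕ} {y : ℕ → F[X]}
    (hy : ∀ k, k ∉ K → (y k).degree = k) {f : F[X]} (hf : f ∈ Submodule.span F (y '' Kᶜ))
    (h0 : f ≠ 0) : f.natDegree ∉ K := by
  rw [Finsupp.mem_span_image_iff_linearCombination] at hf
  obtain ⟨l, hl, rfl⟩ := hf
  rw [Finsupp.mem_supported] at hl
  have hdeg : ∀ i ∈ l.support, (l i • y i).natDegree = i := by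
    intro i hi
    rw [natDegree_smul _ (Finsupp.mem_support_iff.1 hi)]
    exact natDegree_eq_of_degree_eq_some (hy i (hl hi))
  rw [Finsupp.linearCombination_apply, Finsupp.sum] at h0 ⊢
  have hne : l.support.Nonempty := by
    rw [Finset.nonempty_iff_ne_empty]
    intro h
    simp [h] at h0
  rw [natDegree_sum_eq_of_disjoint]
  · obtain ⟨k, hk, hk'⟩ := Finset.exists_mem_eq_sup l.support hne
      fun i => (l i • y i).natDegree
    rw [hk', hdeg k hk]
    exact hl hk
  · rintro i ⟨hi, -⟩ j ⟨hj, -⟩ hij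
    simp only [Function.onFun, Function.comp_apply]
    rw [hdeg i hi, hdeg j hj]
    exact hij

theorem exists_three_not_mem (K : Finset ℕ) :
    ∃ i j k : ℕ, i ∉ K ∧ j ∉ K ∧ k ∉ K ∧ i < j ∧ j < k := by
  have h : (K : Set ℕ)ᶜ.Infinite := K.finite_toSet.infinite_compl
  obtain ⟨i, hi, -⟩ := h.exists_gt 0
  obtain ⟨j, hj, hij⟩ := h.exists_gt i
  obtain ⟨k, hk, hjk⟩ := h.exists_gt j
  exact ⟨i, j, k, by simpa using hi, by simpa using hj, by simpa using hk, hij, hjk⟩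

/-- Degree bounds for the coefficients of an operator with eigenpolynomials of almost every
degree. -/
theorem natDegree_coeffs_le [CharZero F] {P Q R E : F[X]} {K : Finset ℕ} {y : ℕ → F[X]}
    (hy : ∀ k, k ∉ K → (y k).degree = k)
    (heig : ∀ k, k ∉ K → ∃ c : F, E * (C c * y k) = polyOp P Q R (y k)) :
    P.natDegree ≤ E.natDegree + 2 ∧ Q.natDegree ≤ E.natDegree + 1 ∧
      R.natDegree ≤ E.natDegree := by
  -- `e - 2 - E.natDegree` is the amount by which the operator could raise degrees. If it is
  -- positive, the indicial polynomial at infinity vanishes at every `k ∉ K`, hence identically,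
  -- contrary to the choice of `e`.
  set e := max P.natDegree (max (Q.natDegree + 1) (R.natDegree + 2)) with he
  by_cases hle : e ≤ E.natDegree + 2
  · have h1 : P.natDegree ≤ e := le_max_left _ _
    have h2 : Q.natDegree + 1 ≤ e := (le_max_left _ _).trans (le_max_right _ _)
    have h3 : R.natDegree + 2 ≤ e := (le_max_right _ _).trans (le_max_right _ _)
    omega
  exfalso
  have hP : P.natDegree ≤ e := le_max_left _ _
  have hQ : (X * Q).natDegree ≤ e := by
    refine natDegree_mul_le.trans ?_
    rw [natDegree_X, add_comm]
    exact (le_max_left _ _).trans (le_max_right _ _)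
  have hR : (X ^ 2 * R).natDegree ≤ e := by
    refine natDegree_mul_le.trans ?_
    rw [natDegree_X_pow, add_comm]
    exact (le_max_right _ _).trans (le_max_right _ _)
  have hind : ∀ k, k ∉ K → indicial (P.coeff e) ((X * Q).coeff e) ((X ^ 2 * R).coeff e) k = 0 := by
    intro k hk
    obtain ⟨c, hc⟩ := heig k hk
    have hyk := natDegree_eq_of_degree_eq_some (hy k hk)
    have hyk0 : (y k).coeff k ≠ 0 := by
      have h0 : y k ≠ 0 := by intro h; simpa [h] using hy k hk
      have := leadingCoeff_ne_zero.2 h0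
      rwa [leadingCoeff, hyk] at this
    have hc1 : (X * derivative (y k)).coeff k = k * (y k).coeff k := by
      rcases k with _ | k
      · simp
      · rw [coeff_X_mul, coeff_derivative]; push_cast; ring
    have hc2 : (X ^ 2 * derivative (derivative (y k))).coeff k = k * (k - 1) * (y k).coeff k := by
      rcases k with _ | _ | k
      · simp
      · rw [coeff_X_pow_mul']; simp
      · rw [coeff_X_pow_mul, coeff_derivative, coeff_derivative]; push_cast; ring
    have hd1 : (X * derivative (y k)).natDegree ≤ k := by
      rcases k with _ | k
      · rw [eq_C_of_natDegree_eq_zero hyk]; simp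
      · refine natDegree_mul_le.trans ?_
        have := natDegree_derivative_le (y (k + 1))
        rw [natDegree_X]; omega
    have hd2 : (X ^ 2 * derivative (derivative (y k))).natDegree ≤ k := by
      rcases k with _ | _ | k
      · rw [eq_C_of_natDegree_eq_zero hyk]; simp
      · have : derivative (derivative (y 1)) = 0 := by
          rw [eq_X_add_C_of_natDegree_le_one hyk.le]; simp
        simp [this]
      · refine natDegree_mul_le.trans ?_
        have h1 := natDegree_derivative_le (y (k + 1 + 1))
        have h2 := natDegree_derivative_le (derivative (y (k + 1 + 1)))
        rw [natDegree_X_pow]; omega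
    have hz : (X ^ 2 * (E * (C c * y k))).coeff (e + k) = 0 := by
      refine coeff_eq_zero_of_natDegree_lt ?_
      refine natDegree_mul_le.trans_lt ?_
      have h1 : (E * (C c * y k)).natDegree ≤ _ := natDegree_mul_le
      have h2 := natDegree_C_mul_le c (y k)
      rw [natDegree_X_pow]
      omega
    rw [hc, polyOp, show X ^ 2 * (P * derivative (derivative (y k)) + Q * derivative (y k) +
      R * y k) = P * (X ^ 2 * derivative (derivative (y k))) + (X * Q) * (X * derivative (y k)) +
      (X ^ 2 * R) * y k by ring, coeff_add, coeff_add, coeff_mul_add_eq_of_natDegree_le hP hd2,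
      coeff_mul_add_eq_of_natDegree_le hQ hd1, coeff_mul_add_eq_of_natDegree_le hR hyk.le, hc1, hc2] at hz
    refine mul_right_cancel₀ hyk0 ?_
    rw [indicial, zero_mul, ← hz]
    ring
  obtain ⟨i, j, k, hi, hj, hk, hij, hjk⟩ := exists_three_not_mem K
  obtain ⟨h1, h2, h3⟩ := indicial_three hij.ne (hij.trans hjk).ne hjk.ne (hind i hi) (hind j hj)
    (hind k hk)
  have hcases : e = P.natDegree ∨ e = Q.natDegree + 1 ∨ e = R.natDegree + 2 := by omega
  rcases hcases with h | h | h
  · rw [h, coeff_natDegree, leadingCoeff_eq_zero] at h1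
    rw [h1] at h; simp at h; omega
  · rw [h, coeff_X_mul, coeff_natDegree, leadingCoeff_eq_zero] at h2
    rw [h2] at h; simp at h; omega
  · rw [h, coeff_X_pow_mul, coeff_natDegree, leadingCoeff_eq_zero] at h3
    rw [h3] at h; simp at h; omega

theorem natDegree_polyOp_le {P Q R f : F[X]} {n : ℕ} (hP : P.natDegree ≤ n + 2)
    (hQ : Q.natDegree ≤ n + 1) (hR : R.natDegree ≤ n) :
    (polyOp P Q R f).natDegree ≤ n + f.natDegree := by
  have h1 := natDegree_derivative_le f
  have h2 := natDegree_derivative_le (derivative f)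
  refine natDegree_add_le_of_degree_le (natDegree_add_le_of_degree_le ?_ ?_) ?_
  · rcases Nat.lt_or_ge f.natDegree 2 with h | h
    · have : derivative (derivative f) = 0 := by
        rw [eq_X_add_C_of_natDegree_le_one (p := f) (by omega)]; simp
      simp [this]
    · refine natDegree_mul_le.trans ?_
      omega
  · rcases Nat.lt_or_ge f.natDegree 1 with h | h
    · have : derivative f = 0 := by
        rw [eq_C_of_natDegree_eq_zero (p := f) (by omega)]; simp
      simp [this]
    · refine natDegree_mul_le.trans ?_
      omega
  · refine natDegree_mul_le.trans ?_
    omega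

theorem natDegree_le_of_mul_eq_polyOp {P Q R E f g : F[X]} (hE : E ≠ 0)
    (hP : P.natDegree ≤ E.natDegree + 2)
    (hQ : Q.natDegree ≤ E.natDegree + 1) (hR : R.natDegree ≤ E.natDegree)
    (h : E * g = polyOp P Q R f) : g.natDegree ≤ f.natDegree := by
  by_cases hg : g = 0
  · simp [hg]
  have := natDegree_polyOp_le (f := f) hP hQ hR
  rw [← h, natDegree_mul hE hg] at this
  omega

/-- A polynomial space, invariant under an operator with eigenpolynomials `y k`, contains no
further polynomials, if the operator has no Jordan blocks and no further eigenpolynomials. -/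
theorem le_span_of_invariant {P Q R E : F[X]} (hE : E ≠ 0) {K : Set ℕ} {y : ℕ → F[X]}
    (hP : P.natDegree ≤ E.natDegree + 2)
    (hQ : Q.natDegree ≤ E.natDegree + 1) (hR : R.natDegree ≤ E.natDegree)
    (hy : ∀ k, k ∉ K → (y k).degree = k)
    (heig : ∀ k, k ∉ K → ∃ c : F, E * (C c * y k) = polyOp P Q R (y k))
    (hno : ∀ k ∈ K, ∀ (f : F[X]) (c : F), f.degree = k → E * (C c * f) ≠ polyOp P Q R f)
    (hsym : ∀ (g h : F[X]) (c : F), E * (C c * g + h) = polyOp P Q R g →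
      E * (C c * h) = polyOp P Q R h → h = 0)
    {V : Submodule F F[X]} (hyV : ∀ k, k ∉ K → y k ∈ V)
    (hV : ∀ f ∈ V, ∃ g ∈ V, E * g = polyOp P Q R f) :
    V ≤ Submodule.span F (y '' Kᶜ) := by
  have key : ∀ n : ℕ, ∀ f ∈ V, f.degree < n →
      f ∈ Submodule.span F (y '' {k | k < n ∧ k ∉ K}) := by
    intro n
    induction n with
    | zero =>
      intro f _ hf
      have : f = 0 := by
        rw [← degree_eq_bot]
        simpa [Nat.WithBot.lt_zero_iff] using hf
      simp [this]
    | succ n ih =>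
      intro f hfV hf
      have hmono : Submodule.span F (y '' {k | k < n ∧ k ∉ K}) ≤
          Submodule.span F (y '' {k | k < n + 1 ∧ k ∉ K}) :=
        Submodule.span_mono (Set.image_mono fun k (hk : k < n ∧ k ∉ K) =>
          (⟨hk.1.trans (Nat.lt_succ_self n), hk.2⟩ : k < n + 1 ∧ k ∉ K))
      by_cases hfn : f.degree < n
      · exact hmono (ih f hfV hfn)
      have hfd : f.degree = n := by
        refine le_antisymm ?_ (not_lt.1 hfn)
        rw [← natDegree_le_iff_degree_le]
        have h0 : f ≠ 0 := by rintro rfl; simp at hfn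
        exact Nat.lt_succ_iff.1 ((natDegree_lt_iff_degree_lt h0).2 hf)
      have hred : ∀ g h : F[X], g.degree = n → h.degree < (n + 1 : ℕ) →
          (h - C (h.coeff n / g.coeff n) * g).degree < n := by
        intro g h hg hh
        have hg0 : g.coeff n ≠ 0 := by
          have : g ≠ 0 := by rintro rfl; simp at hg
          rw [← natDegree_eq_of_degree_eq_some hg]
          exact leadingCoeff_ne_zero.2 this
        rw [degree_lt_iff_coeff_zero]
        intro m hm
        rcases hm.lt_or_eq with hm | rfl
        · rw [coeff_sub, coeff_C_mul, coeff_eq_zero_of_degree_lt (n := m) (p := g),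
            coeff_eq_zero_of_degree_lt (n := m) (p := h)]
          · simp
          · exact hh.trans_le (by exact_mod_cast hm)
          · rw [hg]; exact_mod_cast hm
        · simp [hg0]
      by_cases hn : n ∈ K
      · exfalso
        obtain ⟨g, hgV, hg⟩ := hV f hfV
        have hgd : g.degree < (n + 1 : ℕ) := by
          have := natDegree_le_of_mul_eq_polyOp hE hP hQ hR hg
          rw [natDegree_eq_of_degree_eq_some hfd] at this
          exact (natDegree_le_iff_degree_le.1 this).trans_lt (by exact_mod_cast Nat.lt_succ_self n)
        -- The only eigenvalue possible for a polynomial with the leading term of `f`; `T f - c f`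
        -- has smaller degree.
        set c := g.coeff n / f.coeff n with hc
        have hh : g - C c * f ∈ Submodule.span F (y '' {k | k < n ∧ k ∉ K}) :=
          ih _ (V.sub_mem hgV (by rw [← smul_eq_C_mul]; exact V.smul_mem c hfV))
            (hred f g hfd hgd)
        -- Decomposition `h = h₀ + (T - c) u` with `h₀` in the kernel of `T - c`, possible because
        -- `T` is diagonal on this span. Then `(T - c) (f - u) = h₀`, so `h₀ = 0` in the absence of
        -- Jordan blocks, and `f - u` is a forbidden eigenpolynomial.
        have hsplit : ∀ h ∈ Submodule.span F (y '' {k | k < n ∧ k ∉ K}),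
            ∃ u h₀ : F[X], u.degree < n ∧ E * (C c * h₀) = polyOp P Q R h₀ ∧
              E * (h - h₀ + C c * u) = polyOp P Q R u := by
          intro h hh
          induction hh using Submodule.span_induction with
          | mem h hh =>
            obtain ⟨k, ⟨hk, hkK⟩, rfl⟩ := hh
            obtain ⟨b, hb⟩ := heig k hkK
            by_cases hbc : b = c
            · refine ⟨0, y k, ?_, hbc ▸ hb, ?_⟩
              · simp
              · simp [polyOp]
            · refine ⟨C (b - c)⁻¹ * y k, 0, ?_, ?_, ?_⟩
              · rw [degree_C_mul (inv_ne_zero (sub_ne_zero.2 hbc)), hy k hkK]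
                exact_mod_cast hk
              · simp [polyOp]
              · rw [polyOp_C_mul, ← hb]
                have : C (b - c)⁻¹ * (C b - C c) = (1 : F[X]) := by
                  rw [← C_sub, ← C_mul, inv_mul_cancel₀ (sub_ne_zero.2 hbc), C_1]
                linear_combination (-E * y k) * this
          | zero => exact ⟨0, 0, by simp, by simp [polyOp], by simp [polyOp]⟩
          | add h₁ h₂ _ _ e₁ e₂ =>
            obtain ⟨u₁, k₁, a₁, b₁, c₁⟩ := e₁
            obtain ⟨u₂, k₂, a₂, b₂, c₂⟩ := e₂
            refine ⟨u₁ + u₂, k₁ + k₂, ?_, ?_, ?_⟩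
            · exact (degree_add_le _ _).trans_lt (max_lt a₁ a₂)
            · rw [polyOp_add, ← b₁, ← b₂]; ring
            · rw [polyOp_add, ← c₁, ← c₂]; ring
          | smul r h _ e =>
            obtain ⟨u, k, a, b, e⟩ := e
            refine ⟨C r * u, C r * k, ?_, ?_, ?_⟩
            · rw [← smul_eq_C_mul]; exact (degree_smul_le _ _).trans_lt a
            · rw [polyOp_C_mul, ← b]; ring
            · rw [polyOp_C_mul, ← e, smul_eq_C_mul]; ring
        obtain ⟨u, h₀, hu, hh₀, he⟩ := hsplit _ hh
        have hz : h₀ = 0 := by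
          refine hsym (f - u) h₀ c ?_ hh₀
          rw [polyOp_sub, ← hg, ← he]; ring
        refine hno n hn (f - u) c ?_ ?_
        · rw [degree_sub_eq_left_of_degree_lt (hfd ▸ hu), hfd]
        · rw [polyOp_sub, ← hg, ← he, hz]; ring
      · have h1 := ih _ (V.sub_mem hfV (by
          rw [← smul_eq_C_mul]; exact V.smul_mem _ (hyV n hn))) (hred (y n) f (hy n hn) hf)
        have h2 : (f.coeff n / (y n).coeff n) • y n ∈
            Submodule.span F (y '' {k | k < n + 1 ∧ k ∉ K}) :=
          Submodule.smul_mem _ _ (Submodule.subset_span ⟨n, ⟨Nat.lt_succ_self n, hn⟩, rfl⟩)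
        have h3 := Submodule.add_mem _ (hmono h1) h2
        rw [smul_eq_C_mul] at h3
        simpa using h3
  intro f hf
  exact Submodule.span_mono (Set.image_mono fun k hk => hk.2) (key (f.natDegree + 1) f hf
    (degree_le_natDegree.trans_lt (by exact_mod_cast Nat.lt_succ_self _)))

/-! ### The polynomial `η` and the poles of the first-order coefficient. -/

/-- The denominator attached to a polynomial space: its order at `ξ` is the number of local
gaps. -/
def gapPoly (U : Submodule F F[X]) (S : Finset F) : F[X] :=
  ∏ ξ ∈ S, (X - C ξ) ^ gapCount U ξ

theorem gapPoly_monic (U : Submodule F F[X]) (S : Finset F) : (gapPoly U S).Monic :=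
  monic_prod_of_monic _ _ fun ξ _ => (monic_X_sub_C ξ).pow _

theorem natDegree_gapPoly (U : Submodule F F[X]) (S : Finset F) :
    (gapPoly U S).natDegree = ∑ ξ ∈ S, gapCount U ξ := by
  rw [gapPoly, natDegree_prod_of_monic _ _ fun ξ _ => (monic_X_sub_C ξ).pow _]
  simp

theorem exists_gapPoly_eq (U : Submodule F F[X]) (S : Finset F)
    (hS : ∀ ξ, ξ ∉ S → gapCount U ξ = 0) (ξ : F) :
    ∃ u : F[X], gapPoly U S = (X - C ξ) ^ gapCount U ξ * u ∧ u.eval ξ ≠ 0 := by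
  classical
  by_cases hξ : ξ ∈ S
  · refine ⟨∏ ζ ∈ S.erase ξ, (X - C ζ) ^ gapCount U ζ, (Finset.mul_prod_erase S _ hξ).symm, ?_⟩
    rw [eval_prod, Finset.prod_ne_zero_iff]
    intro ζ hζ
    simp [sub_ne_zero.2 (Finset.ne_of_mem_erase hζ).symm]
  · refine ⟨gapPoly U S, by simp [hS ξ hξ], ?_⟩
    rw [gapPoly, eval_prod, Finset.prod_ne_zero_iff]
    intro ζ hζ
    have : ξ - ζ ≠ 0 := sub_ne_zero.2 (by rintro rfl; exact hξ hζ)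
    simp [this]

/-- The global structure of an operator `(P D² + Q D + R) / E` preserving a polynomial space of
finite codimension. -/
theorem global_structure [IsAlgClosed F] [CharZero F] {P Q R E : F[X]} (hP : P ≠ 0)
    (hE : E ≠ 0) {U : Submodule F F[X]} (hU : ∀ f ∈ U, ∃ g ∈ U, E * g = polyOp P Q R f)
    (hfin : ∀ ξ, (orders U ξ)ᶜ.Finite) :
    E ∣ P ∧ {ξ | gapCount U ξ ≠ 0}.Finite ∧
      ∀ (p : F[X]) (S : Finset F), P = p * E → (∀ ξ, ξ ∉ S → gapCount U ξ = 0) →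
        E * gapPoly U S ∣ Q * gapPoly U S + 2 * p * E * derivative (gapPoly U S) := by
  refine ⟨?_, ?_, ?_⟩
  · refine dvd_of_local hE fun ξ d v hEv hv => ?_
    obtain ⟨d', v', A, B, Γ, hEv', hv', hA, -⟩ := local_structure hP hE hU ξ (hfin ξ)
    obtain rfl := pow_mul_inj hv hv' (hEv.symm.trans hEv')
    exact ⟨A, hA⟩
  · refine Set.Finite.subset (rootSet_finite (P * E) F) fun ξ hξ => ?_
    rw [mem_rootSet]
    refine ⟨mul_ne_zero hP hE, ?_⟩
    obtain ⟨d, v, A, B, Γ, hEv, hv, hA, hB, -, hAB⟩ := local_structure hP hE hU ξ (hfin ξ)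
    simp only [coe_aeval_eq_eval, eval_mul, mul_eq_zero]
    by_contra! hc
    rcases d with _ | d
    -- At a point where neither `P` nor `E` vanishes, the residue is zero and the leading
    -- coefficient is not, so there are no gaps.
    · have h1 : B.eval ξ = 0 := by
        have := congrArg (eval ξ) hB
        simpa using this.symm
      have h2 : A.eval ξ ≠ 0 := by
        have := congrArg (eval ξ) hA
        simp only [pow_zero, one_mul] at this
        rw [← this]; exact hc.1
      rw [h1, eq_comm] at hAB
      simp [h2] at hAB
      exact hξ hAB
    · apply hc.2
      rw [hEv]; simp
  · intro p S hp hS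
    refine dvd_of_local (mul_ne_zero hE (gapPoly_monic U S).ne_zero) fun ξ d' u' he hu' => ?_
    obtain ⟨d, v, A, B, Γ, hEv, hv, hA, hB, -, hAB⟩ := local_structure hP hE hU ξ (hfin ξ)
    obtain ⟨u, hu, hu0⟩ := exists_gapPoly_eq U S hS ξ
    set ν := gapCount U ξ
    have hx : (X - C ξ : F[X]) ≠ 0 := X_sub_C_ne_zero ξ
    have hd : d' = d + ν := by
      refine pow_mul_inj hu' (g := v * u) (by simp [hv, hu0]) ?_
      rw [← he]
      nth_rw 1 [hEv]
      rw [hu]; ring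
    have hApv : A = p * v := by
      refine mul_left_cancel₀ (pow_ne_zero d hx) ?_
      rw [← hA, hp, hEv]; ring
    -- The residue `-2 ν p(ξ)` of `Q / E` cancels that of `2 p η' / η`; this supplies the one extra
    -- factor `X - ξ` needed.
    have hbr : (B * u + 2 * p * v * (C (ν : F) * u + (X - C ξ) * derivative u)).eval ξ = 0 := by
      have : B.eval ξ = -2 * ν * (p.eval ξ * v.eval ξ) := by rw [hAB, hApv, eval_mul]
      simp [this]; ring
    obtain ⟨c, hc⟩ := dvd_iff_isRoot.2 hbr
    rw [hd]
    refine ⟨c, mul_left_cancel₀ hx ?_⟩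
    have h1 := X_sub_C_mul_derivative_pow_mul ξ ν u
    rw [hu]
    calc _ = ((X - C ξ) * Q) * ((X - C ξ) ^ ν * u) +
          2 * p * E * ((X - C ξ) * derivative ((X - C ξ) ^ ν * u)) := by ring
      _ = (X - C ξ) ^ (d + ν) * (B * u + 2 * p * v * (C (ν : F) * u +
          (X - C ξ) * derivative u)) := by
        rw [h1, hB]
        nth_rw 1 [hEv]
        ring
      _ = _ := by rw [hc]; ring

end Algebra

/-! ### Descent from complex to real polynomials, and the structure theorem. -/

section Complexification

open ComplexConjugate

theorem exists_map_eq_of_conj_eq {f : ℂ[X]} (hf : f.map (starRingEnd ℂ) = f) :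
    ∃ g : ℝ[X], g.map (algebraMap ℝ ℂ) = f := by
  rw [← mem_lifts, lifts_iff_coeff_lifts]
  intro n
  have := congrArg (fun g => g.coeff n) hf
  simp only [coeff_map] at this
  obtain ⟨r, hr⟩ := Complex.conj_eq_iff_real.1 this
  exact ⟨r, hr.symm⟩

theorem map_conj_map_conj (f : ℂ[X]) :
    (f.map (starRingEnd ℂ)).map (starRingEnd ℂ) = f := by
  ext n; simp

theorem map_conj_map_real (f : ℝ[X]) :
    (f.map (algebraMap ℝ ℂ)).map (starRingEnd ℂ) = f.map (algebraMap ℝ ℂ) := by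
  ext n; simp

/-- Real and imaginary part of a complex polynomial. -/
theorem exists_re_im (f : ℂ[X]) : ∃ g h : ℝ[X],
    g.map (algebraMap ℝ ℂ) = C (1 / 2) * (f + f.map (starRingEnd ℂ)) ∧
    h.map (algebraMap ℝ ℂ) = C (-Complex.I / 2) * (f - f.map (starRingEnd ℂ)) ∧
    f = g.map (algebraMap ℝ ℂ) + C Complex.I * h.map (algebraMap ℝ ℂ) := by
  obtain ⟨g, hg⟩ := exists_map_eq_of_conj_eq (f := C (1 / 2) * (f + f.map (starRingEnd ℂ))) (by
    simp only [Polynomial.map_mul, Polynomial.map_add, map_conj_map_conj, map_C, map_div₀, map_one,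
      map_ofNat]
    ring)
  obtain ⟨h, hh⟩ := exists_map_eq_of_conj_eq
    (f := C (-Complex.I / 2) * (f - f.map (starRingEnd ℂ))) (by
    have hI : (starRingEnd ℂ) (-Complex.I / 2) = -(-Complex.I / 2) := by
      rw [map_div₀, map_neg, Complex.conj_I, map_ofNat]; ring
    simp only [Polynomial.map_mul, Polynomial.map_sub, map_conj_map_conj, map_C, hI,
      C_neg (a := -Complex.I / 2)]
    ring)
  refine ⟨g, h, hg, hh, ?_⟩
  rw [hg, hh, ← mul_assoc, ← C_mul, show Complex.I * (-Complex.I / 2) = 1 / 2 by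
    rw [mul_div_assoc', mul_neg, Complex.I_mul_I, neg_neg], ← mul_add]
  rw [show f + f.map (starRingEnd ℂ) + (f - f.map (starRingEnd ℂ)) = C 2 * f by
    rw [show (C 2 : ℂ[X]) = 2 from rfl]; ring, ← mul_assoc, ← C_mul]
  norm_num

variable {y : ℕ → ℝ[X]} {s : Set ℕ}

/-- The complex span of real polynomials. -/
def complexSpan (y : ℕ → ℝ[X]) (s : Set ℕ) : Submodule ℂ ℂ[X] :=
  Submodule.span ℂ ((fun k => (y k).map (algebraMap ℝ ℂ)) '' s)

theorem conj_mem_complexSpan {f : ℂ[X]} (hf : f ∈ complexSpan y s) :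
    f.map (starRingEnd ℂ) ∈ complexSpan y s := by
  induction hf using Submodule.span_induction with
  | mem f hf =>
    obtain ⟨k, hk, rfl⟩ := hf
    rw [map_conj_map_real]
    exact Submodule.subset_span ⟨k, hk, rfl⟩
  | zero => simp
  | add f g _ _ hf hg => rw [Polynomial.map_add]; exact Submodule.add_mem _ hf hg
  | smul c f _ hf =>
    rw [smul_eq_C_mul, Polynomial.map_mul, map_C, ← smul_eq_C_mul]
    exact Submodule.smul_mem _ _ hf

theorem map_mem_complexSpan {f : ℝ[X]} (hf : f ∈ Submodule.span ℝ (y '' s)) :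
    f.map (algebraMap ℝ ℂ) ∈ complexSpan y s := by
  induction hf using Submodule.span_induction with
  | mem f hf =>
    obtain ⟨k, hk, rfl⟩ := hf
    exact Submodule.subset_span ⟨k, hk, rfl⟩
  | zero => simp
  | add f g _ _ hf hg => rw [Polynomial.map_add]; exact Submodule.add_mem _ hf hg
  | smul c f _ hf =>
    rw [smul_eq_C_mul, Polynomial.map_mul, map_C, ← smul_eq_C_mul]
    exact Submodule.smul_mem _ _ hf

theorem conj_mem_localClosure {f : ℂ[X]} {ξ : ℂ} (hf : f ∈ localClosure (complexSpan y s) ξ) :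
    f.map (starRingEnd ℂ) ∈ localClosure (complexSpan y s) (conj ξ) := by
  intro M
  obtain ⟨u, hu, h⟩ := hf M
  refine ⟨_, conj_mem_complexSpan hu, ?_⟩
  have := Polynomial.map_dvd (starRingEnd ℂ) h
  simpa using this

theorem conj_mem_orders {ξ : ℂ} {k : ℕ} (hk : k ∈ orders (complexSpan y s) ξ) :
    k ∈ orders (complexSpan y s) (conj ξ) := by
  obtain ⟨g, hg, h⟩ := hk
  refine ⟨g.map (starRingEnd ℂ), ?_, ?_⟩
  · rw [eval_map_apply]
    simpa using hg
  · simpa using conj_mem_complexSpan h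

theorem gapCount_conj (ξ : ℂ) :
    gapCount (complexSpan y s) (conj ξ) = gapCount (complexSpan y s) ξ := by
  have : orders (complexSpan y s) (conj ξ) = orders (complexSpan y s) ξ := by
    ext k
    exact ⟨fun h => by simpa using conj_mem_orders h, conj_mem_orders⟩
  rw [gapCount, gapCount, this]

/-- Conjugation preserves `U`, hence permutes the points with gaps and keeps their multiplicities;
this makes `η` real. -/
theorem gapPoly_conj {S : Finset ℂ}
    (hS : ∀ ξ, ξ ∈ S ↔ gapCount (complexSpan y s) ξ ≠ 0) :
    (gapPoly (complexSpan y s) S).map (starRingEnd ℂ) = gapPoly (complexSpan y s) S := by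
  rw [gapPoly, Polynomial.map_prod]
  refine Finset.prod_bij' (fun ξ _ => conj ξ) (fun ξ _ => conj ξ) ?_ ?_ ?_ ?_ ?_
  · intro ξ hξ; rw [hS, gapCount_conj, ← hS]; exact hξ
  · intro ξ hξ; rw [hS, gapCount_conj, ← hS]; exact hξ
  · simp
  · simp
  · intro ξ _; simp [gapCount_conj]

theorem map_polyOp (P Q R f : ℝ[X]) : (polyOp P Q R f).map (algebraMap ℝ ℂ) =
    polyOp (P.map (algebraMap ℝ ℂ)) (Q.map (algebraMap ℝ ℂ)) (R.map (algebraMap ℝ ℂ))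
      (f.map (algebraMap ℝ ℂ)) := by
  simp [polyOp, Polynomial.map_add, Polynomial.map_mul, derivative_map]

/-- In `t = Q / E + 2 p η' / η` both terms grow at most linearly at infinity. -/
theorem natDegree_le_one_of_mul_eq {E η p Q t : ℝ[X]} (hE : E ≠ 0) (hη : η ≠ 0)
    (hp : p.natDegree ≤ 2) (hQ : Q.natDegree ≤ E.natDegree + 1)
    (h : E * η * t = Q * η + 2 * p * E * derivative η) : t.natDegree ≤ 1 := by
  by_cases ht : t = 0
  · simp [ht]
  have h1 : (Q * η + 2 * p * E * derivative η).natDegree ≤ E.natDegree + η.natDegree + 1 := by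
    refine natDegree_add_le_of_degree_le (natDegree_mul_le.trans (by omega)) ?_
    rcases Nat.eq_zero_or_pos η.natDegree with h0 | h0
    · rw [eq_C_of_natDegree_eq_zero h0]; simp
    · have h2 := natDegree_derivative_le η
      have h3 : (2 * p * E * derivative η).natDegree ≤ _ := natDegree_mul_le
      have h4 : (2 * p * E).natDegree ≤ _ := natDegree_mul_le
      have h5 : (2 * p).natDegree ≤ p.natDegree := natDegree_C_mul_le 2 p
      omega
  rw [← h, natDegree_mul (mul_ne_zero hE hη) ht, natDegree_mul hE hη] at h1
  omega

/-- The structure theorem for operators `(P D² + Q D + R) / E` with eigenpolynomials of every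
degree not in a finite set `K`. -/
theorem structure_theorem {P Q R E : ℝ[X]} (hP : P ≠ 0) (hE : E ≠ 0) {K : Finset ℕ}
    {y : ℕ → ℝ[X]} (hy : ∀ k, k ∉ K → (y k).degree = k)
    (heig : ∀ k, k ∉ K → ∃ c : ℝ, E * (C c * y k) = polyOp P Q R (y k))
    (hno : ∀ k ∈ K, ∀ (f : ℝ[X]) (c : ℝ), f.degree = k → E * (C c * f) ≠ polyOp P Q R f)
    (hsym : ∀ p, P = p * E → ∀ (g h : ℝ[X]) (c : ℝ), E * (C c * g + h) = polyOp P Q R g →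
      E * (C c * h) = polyOp P Q R h → h = 0) :
    ∃ p t η : ℝ[X], P = p * E ∧ p.natDegree ≤ 2 ∧ t.natDegree ≤ 1 ∧ η.degree = K.card ∧
      E * η * t = Q * η + 2 * p * E * derivative η := by
  have hinj : Function.Injective (algebraMap ℝ ℂ) := (algebraMap ℝ ℂ).injective
  obtain ⟨hdP, hdQ, hdR⟩ := natDegree_coeffs_le hy heig
  set U := complexSpan y ((K : Set ℕ)ᶜ) with hUdef
  have hP' : P.map (algebraMap ℝ ℂ) ≠ 0 := (Polynomial.map_ne_zero_iff hinj).2 hP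
  have hE' : E.map (algebraMap ℝ ℂ) ≠ 0 := (Polynomial.map_ne_zero_iff hinj).2 hE
  have hyc : ∀ k, k ∉ (K : Set ℕ) → ((y k).map (algebraMap ℝ ℂ)).degree = k := by
    intro k hk
    rw [degree_map]
    exact hy k (by simpa using hk)
  have hyU : ∀ k, k ∉ K → (y k).map (algebraMap ℝ ℂ) ∈ U :=
    fun k hk => Submodule.subset_span ⟨k, by simpa using hk, rfl⟩
  have hU : ∀ f ∈ U, ∃ g ∈ U, E.map (algebraMap ℝ ℂ) * g =
      polyOp (P.map (algebraMap ℝ ℂ)) (Q.map (algebraMap ℝ ℂ)) (R.map (algebraMap ℝ ℂ)) f := by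
    intro f hf
    rw [hUdef, complexSpan] at hf
    induction hf using Submodule.span_induction with
    | mem f hf =>
      obtain ⟨k, hk, rfl⟩ := hf
      obtain ⟨c, hc⟩ := heig k (by simpa using hk)
      refine ⟨(c : ℂ) • (y k).map (algebraMap ℝ ℂ), U.smul_mem _ (hyU k (by simpa using hk)), ?_⟩
      rw [← map_polyOp, ← hc]
      simp [smul_eq_C_mul]
    | zero => exact ⟨0, U.zero_mem, by simp [polyOp]⟩
    | add f₁ f₂ _ _ h₁ h₂ =>
      obtain ⟨g₁, m₁, e₁⟩ := h₁
      obtain ⟨g₂, m₂, e₂⟩ := h₂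
      exact ⟨g₁ + g₂, U.add_mem m₁ m₂, by rw [polyOp_add, ← e₁, ← e₂, mul_add]⟩
    | smul c f _ h =>
      obtain ⟨g, m, e⟩ := h
      refine ⟨c • g, U.smul_mem c m, ?_⟩
      rw [smul_eq_C_mul, smul_eq_C_mul, polyOp_C_mul, ← e]; ring
  obtain ⟨hfinU, hcard⟩ := finrank_quotient_of_degrees (U := U) (K := K)
    (fun f hf h0 => by simpa using natDegree_not_mem_of_mem_span hyc hf h0)
    (fun k hk => ⟨_, hyU k hk, hyc k (by simpa using hk)⟩)
  have hfin : ∀ ξ, (orders U ξ)ᶜ.Finite := finite_gaps U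
  obtain ⟨hEP, hSfin, hglob⟩ := global_structure hP' hE' hU hfin
  obtain ⟨p, hp⟩ := (map_dvd_map' (algebraMap ℝ ℂ)).1 hEP
  rw [mul_comm] at hp
  -- The local conditions are complex but `V` is real, because the eigenvalue and symmetry
  -- hypotheses concern real polynomials.
  let V : Submodule ℝ ℝ[X] :=
    { carrier := {f | ∀ ξ, f.map (algebraMap ℝ ℂ) ∈ localClosure U ξ}
      zero_mem' := fun ξ => by simp
      add_mem' := fun {f g} hf hg ξ => by
        rw [Polynomial.map_add]; exact Submodule.add_mem _ (hf ξ) (hg ξ)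
      smul_mem' := fun c f hf ξ => by
        rw [smul_eq_C_mul, Polynomial.map_mul, map_C, ← smul_eq_C_mul]
        exact Submodule.smul_mem _ _ (hf ξ) }
  have hVspan : V ≤ Submodule.span ℝ (y '' (K : Set ℕ)ᶜ) := by
    refine le_span_of_invariant hE hdP hdQ hdR (fun k hk => hy k (by simpa using hk))
      (fun k hk => heig k (by simpa using hk)) (fun k hk => hno k (by simpa using hk))
      (hsym p hp)
      (fun k hk ξ => le_localClosure U ξ (hyU k (by simpa using hk))) ?_
    intro f hf
    obtain ⟨g, hg, he⟩ := localClosure_invariant hP' hE' hU hfin hf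
    rw [← map_polyOp] at he
    obtain ⟨r, hr⟩ := (map_dvd_map' (algebraMap ℝ ℂ)).1 (Dvd.intro _ he)
    have hgr : g = r.map (algebraMap ℝ ℂ) := by
      refine mul_left_cancel₀ hE' ?_
      rw [he, hr, Polynomial.map_mul]
    exact ⟨r, fun ξ => hgr ▸ hg ξ, hr.symm⟩
  have hclosed : ∀ f, (∀ ξ, f ∈ localClosure U ξ) → f ∈ U := by
    intro f hf
    have hf' : ∀ ξ, f.map (starRingEnd ℂ) ∈ localClosure U ξ := fun ξ => by
      simpa using conj_mem_localClosure (hf (conj ξ))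
    obtain ⟨g, h, hg, hh, hfgh⟩ := exists_re_im f
    have hgV : g ∈ V := fun ξ => by
      rw [hg, ← smul_eq_C_mul]
      exact Submodule.smul_mem _ _ (Submodule.add_mem _ (hf ξ) (hf' ξ))
    have hhV : h ∈ V := fun ξ => by
      rw [hh, ← smul_eq_C_mul]
      exact Submodule.smul_mem _ _ (Submodule.sub_mem _ (hf ξ) (hf' ξ))
    rw [hfgh, ← smul_eq_C_mul]
    exact U.add_mem (map_mem_complexSpan (hVspan hgV))
      (U.smul_mem _ (map_mem_complexSpan (hVspan hhV)))
  set S := hSfin.toFinset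
  have hS : ∀ ξ, ξ ∈ S ↔ gapCount U ξ ≠ 0 := fun ξ => by simp [S]
  have hS' : ∀ ξ, ξ ∉ S → gapCount U ξ = 0 := fun ξ => by simp [S]
  obtain ⟨η, hη⟩ := exists_map_eq_of_conj_eq (gapPoly_conj hS)
  have hdvd := hglob (p.map (algebraMap ℝ ℂ)) S (by rw [hp, Polynomial.map_mul]) hS'
  rw [← hη, show E.map (algebraMap ℝ ℂ) * η.map (algebraMap ℝ ℂ) =
    (E * η).map (algebraMap ℝ ℂ) by simp, show Q.map (algebraMap ℝ ℂ) * η.map (algebraMap ℝ ℂ) +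
    2 * p.map (algebraMap ℝ ℂ) * E.map (algebraMap ℝ ℂ) *
      derivative (η.map (algebraMap ℝ ℂ)) =
    (Q * η + 2 * p * E * derivative η).map (algebraMap ℝ ℂ) by simp [derivative_map],
    map_dvd_map'] at hdvd
  obtain ⟨t, ht⟩ := hdvd
  have hη0 : η ≠ 0 := by
    rintro rfl
    have := (gapPoly_monic U S).ne_zero
    rw [← hη] at this
    simp at this
  have hpd : p.natDegree ≤ 2 := by
    have hp0 : p ≠ 0 := by rintro rfl; simp at hp; exact hP hp
    rw [hp, natDegree_mul hp0 hE] at hdP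
    omega
  refine ⟨p, t, η, hp, hpd, natDegree_le_one_of_mul_eq hE hη0 hpd hdQ ht.symm, ?_, ht.symm⟩
  -- The degree of `η` is the total number of gaps, and the codimension of `U` computed locally
  -- equals the one read off from degrees.
  rw [degree_eq_natDegree hη0, ← natDegree_map (algebraMap ℝ ℂ), hη, natDegree_gapPoly,
    ← finrank_quotient_eq_sum hfin hclosed S hS', hcard]

end Complexification

/-! ### Intervals with extended endpoints and their end filters. -/

section Interval

theorem isOpen_interval (a b : EReal) : IsOpen (interval a b) :=
  isOpen_Ioo.preimage continuous_coe_real_ereal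

theorem ordConnected_interval (a b : EReal) : (interval a b).OrdConnected :=
  ⟨fun x hx y hy z hz => ⟨hx.1.trans_le (by exact_mod_cast hz.1),
    lt_of_le_of_lt (by exact_mod_cast hz.2) hy.2⟩⟩

theorem convex_interval (a b : EReal) : Convex ℝ (interval a b) :=
  (ordConnected_interval a b).convex

theorem interval_nonempty {a b : EReal} (h : a < b) : (interval a b).Nonempty := by
  obtain ⟨x, hx, hx'⟩ := EReal.lt_iff_exists_real_btwn.1 h
  exact ⟨x, hx, hx'⟩

theorem interval_infinite {a b : EReal} (h : a < b) : (interval a b).Infinite := by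
  obtain ⟨x, hx⟩ := interval_nonempty h
  exact infinite_of_mem_nhds x ((isOpen_interval a b).mem_nhds hx)

theorem interval_mem_atLeftEnd {a c : EReal} (h : a < c) : interval a c ∈ atLeftEnd a :=
  preimage_mem_comap (Ioo_mem_nhdsGT h)

theorem interval_mem_atRightEnd {c b : EReal} (h : c < b) : interval c b ∈ atRightEnd b :=
  preimage_mem_comap (Ioo_mem_nhdsLT h)

theorem atLeftEnd_neBot {a b : EReal} (h : a < b) : (atLeftEnd a).NeBot := by
  rw [atLeftEnd, comap_neBot_iff]
  intro t ht
  obtain ⟨c, hc, hct⟩ := (mem_nhdsGT_iff_exists_Ioo_subset' h).1 ht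
  obtain ⟨x, hx, hx'⟩ := EReal.lt_iff_exists_real_btwn.1 hc
  exact ⟨x, hct ⟨hx, hx'⟩⟩

theorem atRightEnd_neBot {a b : EReal} (h : a < b) : (atRightEnd b).NeBot := by
  rw [atRightEnd, comap_neBot_iff]
  intro t ht
  obtain ⟨c, hc, hct⟩ := (mem_nhdsLT_iff_exists_Ioo_subset' h).1 ht
  obtain ⟨x, hx, hx'⟩ := EReal.lt_iff_exists_real_btwn.1 hc
  exact ⟨x, hct ⟨hx, hx'⟩⟩

theorem atLeftEnd_coe (a : ℝ) : atLeftEnd (a : EReal) = 𝓝[>] a := by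
  rw [atLeftEnd, nhdsWithin, comap_inf, comap_principal, nhdsWithin,
    EReal.isEmbedding_coe.nhds_eq_comap]
  congr 2
  ext x
  simp

theorem atRightEnd_coe (b : ℝ) : atRightEnd (b : EReal) = 𝓝[<] b := by
  rw [atRightEnd, nhdsWithin, comap_inf, comap_principal, nhdsWithin,
    EReal.isEmbedding_coe.nhds_eq_comap]
  congr 2
  ext x
  simp

theorem tendsto_neg_atLeftEnd (b : EReal) :
    Tendsto (fun x : ℝ => -x) (atLeftEnd (-b)) (atRightEnd b) := by
  rw [atRightEnd, tendsto_comap_iff]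
  have h1 : Tendsto (fun x : EReal => -x) (𝓝[>] (-b)) (𝓝[<] b) := by
    refine tendsto_nhdsWithin_iff.2 ⟨?_, ?_⟩
    · have := (continuous_neg (G := EReal)).tendsto (-b)
      rw [neg_neg] at this
      exact this.mono_left nhdsWithin_le_nhds
    · filter_upwards [self_mem_nhdsWithin] with x hx
      exact EReal.neg_lt_comm.1 hx
  exact h1.comp tendsto_comap

theorem tendsto_neg_atRightEnd (a : EReal) :
    Tendsto (fun x : ℝ => -x) (atRightEnd (-a)) (atLeftEnd a) := by
  rw [atLeftEnd, tendsto_comap_iff]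
  have h1 : Tendsto (fun x : EReal => -x) (𝓝[<] (-a)) (𝓝[>] a) := by
    refine tendsto_nhdsWithin_iff.2 ⟨?_, ?_⟩
    · have := (continuous_neg (G := EReal)).tendsto (-a)
      rw [neg_neg] at this
      exact this.mono_left nhdsWithin_le_nhds
    · filter_upwards [self_mem_nhdsWithin] with x hx
      exact EReal.lt_neg_comm.1 hx
  exact h1.comp tendsto_comap

theorem neg_mem_interval {a b : EReal} {x : ℝ} : -x ∈ interval a b ↔ x ∈ interval (-b) (-a) := by
  simp only [interval, Set.mem_ofPred_eq, EReal.coe_neg]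
  rw [EReal.lt_neg_comm, EReal.neg_lt_comm, and_comm]

/-- A function with non-negative derivative which vanishes at both endpoints is zero. -/
theorem deriv_eq_zero_of_tendsto {a b : EReal} (hab : a < b) {φ φ' : ℝ → ℝ}
    (hφ : ∀ x ∈ interval a b, HasDerivAt φ (φ' x) x) (h0 : ∀ x ∈ interval a b, 0 ≤ φ' x)
    (ha : Tendsto φ (atLeftEnd a) (𝓝 0)) (hb : Tendsto φ (atRightEnd b) (𝓝 0)) :
    ∀ x ∈ interval a b, φ' x = 0 := by
  have hmono : MonotoneOn φ (interval a b) := by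
    refine monotoneOn_of_deriv_nonneg (convex_interval a b)
      (fun x hx => (hφ x hx).continuousAt.continuousWithinAt) ?_ ?_
    · exact fun x hx => (hφ x (interior_subset hx)).differentiableAt.differentiableWithinAt
    · intro x hx
      rw [(hφ x (interior_subset hx)).deriv]
      exact h0 x (interior_subset hx)
  -- A nondecreasing function lies between its limits at the two ends, both zero here.
  have hz : ∀ x ∈ interval a b, φ x = 0 := by
    intro x hx
    have := atLeftEnd_neBot hab
    have := atRightEnd_neBot hab
    apply le_antisymm
    · refine ge_of_tendsto hb ?_
      filter_upwards [interval_mem_atRightEnd hx.2] with z hz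
      exact hmono hx ⟨hx.1.trans hz.1, hz.2⟩ (by exact_mod_cast hz.1.le)
    · refine le_of_tendsto ha ?_
      filter_upwards [interval_mem_atLeftEnd hx.1] with z hz
      exact hmono ⟨hz.1, hz.2.trans hx.2⟩ hx (by exact_mod_cast hz.2.le)
  intro x hx
  have h1 : HasDerivAt φ 0 x := by
    refine (hasDerivAt_const x (0 : ℝ)).congr_of_eventuallyEq ?_
    filter_upwards [(isOpen_interval a b).mem_nhds hx] with z hz'
    exact hz z hz'
  exact (hφ x hx).unique h1

end Interval

/-! ### From rational to polynomial coefficients, and symmetry of the operator. -/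

section Bridge

theorem DiffOp₂.exists_polyOp (T : DiffOp₂) : ∃ P Q R E : ℝ[X], E ≠ 0 ∧ P ≠ 0 ∧
    T.p * algebraMap ℝ[X] (RatFunc ℝ) E = algebraMap ℝ[X] (RatFunc ℝ) P ∧
    T.q * algebraMap ℝ[X] (RatFunc ℝ) E = algebraMap ℝ[X] (RatFunc ℝ) Q ∧
    T.r * algebraMap ℝ[X] (RatFunc ℝ) E = algebraMap ℝ[X] (RatFunc ℝ) R := by
  have key : ∀ f : RatFunc ℝ, f * algebraMap ℝ[X] (RatFunc ℝ) f.denom =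
      algebraMap ℝ[X] (RatFunc ℝ) f.num := by
    intro f
    have h := RatFunc.num_div_denom f
    rwa [div_eq_iff (RatFunc.algebraMap_ne_zero f.denom_ne_zero), eq_comm] at h
  have hp := key T.p
  have hq := key T.q
  have hr := key T.r
  refine ⟨T.p.num * T.q.denom * T.r.denom, T.q.num * T.p.denom * T.r.denom,
    T.r.num * T.p.denom * T.q.denom, T.p.denom * T.q.denom * T.r.denom, ?_, ?_, ?_, ?_, ?_⟩
  · exact mul_ne_zero (mul_ne_zero T.p.denom_ne_zero T.q.denom_ne_zero) T.r.denom_ne_zero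
  · exact mul_ne_zero (mul_ne_zero (RatFunc.num_ne_zero T.p_ne_zero) T.q.denom_ne_zero)
      T.r.denom_ne_zero
  · simp only [map_mul, ← hp]; ring
  · simp only [map_mul, ← hq]; ring
  · simp only [map_mul, ← hr]; ring

theorem DiffOp₂.app_eq_iff {T : DiffOp₂} {P Q R E : ℝ[X]} (hE : E ≠ 0)
    (hp : T.p * algebraMap ℝ[X] (RatFunc ℝ) E = algebraMap ℝ[X] (RatFunc ℝ) P)
    (hq : T.q * algebraMap ℝ[X] (RatFunc ℝ) E = algebraMap ℝ[X] (RatFunc ℝ) Q)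
    (hr : T.r * algebraMap ℝ[X] (RatFunc ℝ) E = algebraMap ℝ[X] (RatFunc ℝ) R) (f g : ℝ[X]) :
    T.app f = algebraMap ℝ[X] (RatFunc ℝ) g ↔ E * g = polyOp P Q R f := by
  have hE' := RatFunc.algebraMap_ne_zero (K := ℝ) hE
  rw [← (RatFunc.algebraMap_injective ℝ).eq_iff, ← mul_right_inj' hE', eq_comm, ← map_mul]
  have : algebraMap ℝ[X] (RatFunc ℝ) E * T.app f =
      algebraMap ℝ[X] (RatFunc ℝ) (polyOp P Q R f) := by
    simp only [polyOp, map_add, map_mul, DiffOp₂.app, ← hp, ← hq, ← hr]; ring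
  rw [this]

/-- The quotient rule holds for any fraction representing `f`, not only the reduced one used in the
definition. -/
theorem ratDeriv_mul_sq (f : RatFunc ℝ) {P E : ℝ[X]} (hE : E ≠ 0)
    (hf : f * algebraMap ℝ[X] (RatFunc ℝ) E = algebraMap ℝ[X] (RatFunc ℝ) P) :
    ratDeriv f * algebraMap ℝ[X] (RatFunc ℝ) E ^ 2 =
      algebraMap ℝ[X] (RatFunc ℝ) (derivative P * E - P * derivative E) := by
  have hE' := RatFunc.algebraMap_ne_zero (K := ℝ) hE
  have hd' := RatFunc.algebraMap_ne_zero (K := ℝ) f.denom_ne_zero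
  have h := RatFunc.num_div_denom f
  have h1 : f.num * E = P * f.denom := by
    apply RatFunc.algebraMap_injective ℝ
    rw [map_mul, map_mul, ← hf]
    nth_rw 2 [← h]
    field_simp
  have h2 := congrArg derivative h1
  simp only [derivative_mul] at h2
  have h3 : (derivative f.num * f.denom - f.num * derivative f.denom) * E ^ 2 =
      (derivative P * E - P * derivative E) * f.denom ^ 2 := by
    linear_combination (E * f.denom) * h2 - (E * derivative f.denom + derivative E * f.denom) * h1
  have h4 := congrArg (algebraMap ℝ[X] (RatFunc ℝ)) h3
  simp only [map_mul, map_sub, map_pow] at h4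
  rw [ratDeriv, div_mul_eq_mul_div, div_eq_iff (pow_ne_zero 2 hd'), h4]
  simp only [map_mul, map_sub]

theorem DiffOp₂.weightLogDeriv_identity {T : DiffOp₂} {p Q E : ℝ[X]} (hE : E ≠ 0)
    (hp : T.p = algebraMap ℝ[X] (RatFunc ℝ) p)
    (hq : T.q * algebraMap ℝ[X] (RatFunc ℝ) E = algebraMap ℝ[X] (RatFunc ℝ) Q) :
    (Q - derivative p * E) * T.weightLogDeriv.denom = T.weightLogDeriv.num * p * E := by
  have hE' := RatFunc.algebraMap_ne_zero (K := ℝ) hE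
  have hd' := RatFunc.algebraMap_ne_zero (K := ℝ) T.weightLogDeriv.denom_ne_zero
  have hp0 := T.p_ne_zero
  have h := RatFunc.num_div_denom T.weightLogDeriv
  have h1 := ratDeriv_mul_sq T.p (P := p) one_ne_zero (by simp [hp])
  simp only [map_one, one_pow, mul_one, derivative_one, mul_zero, sub_zero] at h1
  rw [div_eq_iff hd'] at h
  apply RatFunc.algebraMap_injective ℝ
  simp only [map_mul, map_sub]
  rw [h, ← hq, ← hp, DiffOp₂.weightLogDeriv, ← h1]
  field_simp

/-- At a zero of the denominator, `W > 0` would force the coprime numerator to vanish as well. -/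
theorem denom_eval_ne_zero {T : DiffOp₂} {I : Set ℝ} {W : ℝ → ℝ} (hW : T.IsPositiveWeight I W)
    {x : ℝ} (hx : x ∈ I) : T.weightLogDeriv.denom.eval x ≠ 0 := by
  intro h
  obtain ⟨hpos, d, -, hd⟩ := hW x hx
  rw [h, zero_mul, eq_comm, mul_eq_zero, or_iff_left hpos.ne'] at hd
  obtain ⟨u, v, huv⟩ := RatFunc.isCoprime_num_denom T.weightLogDeriv
  have := congrArg (eval x) huv
  simp [h, hd] at this

/-- The operator of an SL-OPS has no Jordan blocks, since it is symmetric. -/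
theorem IsSLOPS.eq_zero_of_jordan {K : Finset ℕ} {y : ℕ → ℝ[X]} {T : DiffOp₂} {a b : EReal}
    {W : ℝ → ℝ} (h : IsSLOPS K y T a b W) {p Q R E : ℝ[X]} (hE : E ≠ 0)
    (hp : T.p = algebraMap ℝ[X] (RatFunc ℝ) p)
    (hq : T.q * algebraMap ℝ[X] (RatFunc ℝ) E = algebraMap ℝ[X] (RatFunc ℝ) Q)
    {f g : ℝ[X]} {c : ℝ} (hf : E * (C c * f + g) = polyOp (p * E) Q R f)
    (hg : E * (C c * g) = polyOp (p * E) Q R g) : g = 0 := by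
  have hid := T.weightLogDeriv_identity hE hp hq
  have hpe : ∀ x, T.p.eval (RingHom.id ℝ) x = p.eval x := by
    intro x; rw [hp, RatFunc.eval_algebraMap]; simp
  set N := T.weightLogDeriv.num
  set δ := T.weightLogDeriv.denom
  set w := derivative f * g - f * derivative g with hw
  -- Lagrange's identity `(p W w)' = W g²` for the Wronskian `w`, divided by `W` and multiplied by
  -- the denominator `δ` of `W' / W`.
  have hpoly : δ * g ^ 2 = p * δ * derivative w + N * p * w + derivative p * δ * w := by
    refine mul_left_cancel₀ hE ?_
    simp only [polyOp] at hf hg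
    simp only [hw, derivative_sub, derivative_mul]
    linear_combination (δ * g) * hf - (δ * f) * hg + (derivative f * g - f * derivative g) * hid
  have hlim : ∀ l : Filter ℝ, Tendsto (fun x => w.eval x * T.p.eval (RingHom.id ℝ) x * W x) l
      (𝓝 0) → Tendsto (fun x => w.eval x * p.eval x * W x) l (𝓝 0) := by
    intro l hl
    simpa only [hpe] using hl
  have hder : ∀ x ∈ interval a b, HasDerivAt (fun x => w.eval x * p.eval x * W x)
      (W x * (g.eval x) ^ 2) x := by
    intro x hx
    have hδ := denom_eval_ne_zero h.weight hx
    obtain ⟨hpos, d, hd, hd'⟩ := h.weight x hx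
    refine (((w.hasDerivAt x).fun_mul (p.hasDerivAt x)).fun_mul hd).congr_deriv ?_
    refine mul_left_cancel₀ hδ ?_
    have := congrArg (eval x) hpoly
    simp only [eval_mul, eval_add, eval_pow] at this
    linear_combination (w.eval x * p.eval x) * hd' - W x * this
  have hz := deriv_eq_zero_of_tendsto h.lt hder
    (fun x hx => mul_nonneg (h.weight x hx).1.le (sq_nonneg _))
    (hlim _ (h.left_end w)) (hlim _ (h.right_end w))
  refine eq_zero_of_infinite_isRoot g ((interval_infinite h.lt).mono fun x hx => ?_)
  have := hz x hx
  rw [mul_eq_zero, or_iff_right (h.weight x hx).1.ne'] at this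
  exact pow_eq_zero_iff two_ne_zero |>.1 this

end Bridge

/-! ### Endpoint constraints for the Pearson equation. -/

section Pearson

/-- A non-negative solution, positive away from the zeros of `Z`, of the Pearson equation
`p w' = s w` on an interval, with finite moments and vanishing boundary terms. -/
structure IsPearson (p s Z : ℝ[X]) (a b : EReal) (w : ℝ → ℝ) : Prop where
  lt : a < b
  p_ne_zero : p ≠ 0
  Z_ne_zero : Z ≠ 0
  deriv : ∀ x ∈ interval a b, ∃ d, HasDerivAt w d x ∧ p.eval x * d = s.eval x * w x
  pos : ∀ x ∈ interval a b, Z.eval x ≠ 0 → 0 < w x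
  moments : ∀ j : ℕ, IntegrableOn (fun x => x ^ j * w x) (interval a b)
  left_end : Tendsto (fun x => p.eval x * w x) (atLeftEnd a) (𝓝 0)
  right_end : Tendsto (fun x => p.eval x * w x) (atRightEnd b) (𝓝 0)

variable {p s Z : ℝ[X]} {a b : EReal} {w : ℝ → ℝ}

theorem comp_neg_X_ne_zero {p : ℝ[X]} (hp : p ≠ 0) : p.comp (-X) ≠ 0 := by
  intro h
  apply hp
  have := congrArg (fun q => q.comp (-X)) h
  simpa [comp_assoc] using this

theorem IsPearson.reflect (h : IsPearson p s Z a b w) :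
    IsPearson (p.comp (-X)) (-s.comp (-X)) (Z.comp (-X)) (-b) (-a) (fun x => w (-x)) where
  lt := EReal.neg_lt_neg_iff.2 h.lt
  p_ne_zero := comp_neg_X_ne_zero h.p_ne_zero
  Z_ne_zero := comp_neg_X_ne_zero h.Z_ne_zero
  deriv := fun x hx => by
    obtain ⟨d, hd, he⟩ := h.deriv (-x) (neg_mem_interval.2 hx)
    refine ⟨d * -1, hd.comp x (hasDerivAt_neg x), ?_⟩
    simp only [eval_comp, eval_neg, eval_X]
    linear_combination -he
  pos := fun x hx hZ => h.pos (-x) (neg_mem_interval.2 hx) (by simpa [eval_comp] using hZ)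
  moments := fun j => by
    have h1 := ((Measure.measurePreserving_neg (volume : Measure ℝ)).integrableOn_comp_preimage
      (Homeomorph.neg ℝ).measurableEmbedding).2 (h.moments j)
    have h2 : (fun x : ℝ => -x) ⁻¹' interval a b = interval (-b) (-a) := by
      ext x; exact neg_mem_interval
    have h3 := h1.const_mul ((-1) ^ j)
    change IntegrableOn _ ((fun x : ℝ => -x) ⁻¹' interval a b) _ at h3
    rw [h2] at h3
    refine h3.congr_fun (fun x _ => ?_) (isOpen_interval _ _).measurableSet
    simp only [Function.comp_apply]
    rw [← mul_assoc, ← mul_pow]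
    simp
  left_end := by
    have := h.right_end.comp (tendsto_neg_atLeftEnd b)
    simpa [eval_comp, Function.comp_def] using this
  right_end := by
    have := h.left_end.comp (tendsto_neg_atRightEnd a)
    simpa [eval_comp, Function.comp_def] using this

theorem eventually_eval_ne_zero {l : Filter ℝ} (hl : l ≤ cofinite) {q : ℝ[X]} (hq : q ≠ 0) :
    ∀ᶠ x in l, q.eval x ≠ 0 := by
  apply hl
  refine eventually_cofinite.2 ?_
  refine (q.rootSet_finite ℝ).subset fun x hx => ?_
  rw [mem_rootSet]
  exact ⟨hq, by simpa using hx⟩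

theorem hasDerivAt_of_pearson {x : ℝ} (hp : p.eval x ≠ 0)
    (h : ∃ d, HasDerivAt w d x ∧ p.eval x * d = s.eval x * w x) :
    HasDerivAt w (s.eval x / p.eval x * w x) x := by
  obtain ⟨d, hd, he⟩ := h
  refine hd.congr_deriv ?_
  rw [div_mul_eq_mul_div, eq_div_iff hp]
  linear_combination he

/-- At a finite left endpoint, the leading coefficient vanishes. -/
theorem IsPearson.eval_left_eq_zero {a : ℝ} (h : IsPearson p s Z a b w) : p.eval a = 0 := by
  by_contra hpa
  have hle : 𝓝[>] a ≤ cofinite := (nhdsWithin_mono a fun x hx => ne_of_gt hx).trans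
    (nhdsNE_le_cofinite a)
  have hcont : ContinuousAt (fun x => |s.eval x / p.eval x|) a :=
    (s.continuousAt.div p.continuousAt hpa).abs
  -- If `p(a) ≠ 0`, then `M` bounds `w' / w` near `a`, so `w * exp (-M x)` decreases there. Since it
  -- tends to zero at `a`, it cannot be positive.
  set M := |s.eval a / p.eval a| + 1 with hM
  have hbd : ∀ᶠ x in 𝓝[>] a, |s.eval x / p.eval x| < M :=
    (hcont.eventually_lt continuousAt_const (by simp [hM])).filter_mono nhdsWithin_le_nhds
  have hI : ∀ᶠ x in 𝓝[>] a, x ∈ interval a b := by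
    rw [← atLeftEnd_coe]; exact interval_mem_atLeftEnd h.lt
  have hev := ((hI.and hbd).and (eventually_eval_ne_zero hle h.p_ne_zero)).and
    (eventually_eval_ne_zero hle h.Z_ne_zero)
  obtain ⟨c, hac, hc⟩ := mem_nhdsGT_iff_exists_Ioo_subset.1 hev
  have hac' : a < c := hac
  have hder : ∀ x ∈ Set.Ioo a c, HasDerivAt (fun x => w x * Real.exp (-M * x))
      ((s.eval x / p.eval x - M) * w x * Real.exp (-M * x)) x := by
    intro x hx
    obtain ⟨⟨⟨h1, h2⟩, h3⟩, h4⟩ := hc hx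
    have h5 : HasDerivAt (fun x : ℝ => Real.exp (-M * x)) (Real.exp (-M * x) * (-M * 1)) x :=
      ((hasDerivAt_id x).const_mul (-M)).exp
    refine ((hasDerivAt_of_pearson h3 (h.deriv x h1)).fun_mul h5).congr_deriv ?_
    ring
  have hanti : AntitoneOn (fun x => w x * Real.exp (-M * x)) (Set.Ioo a c) := by
    refine antitoneOn_of_deriv_nonpos (convex_Ioo a c)
      (fun x hx => (hder x hx).continuousAt.continuousWithinAt) ?_ ?_
    · exact fun x hx => (hder x (interior_subset hx)).differentiableAt.differentiableWithinAt
    · intro x hx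
      have hx := interior_subset hx
      rw [(hder x hx).deriv]
      obtain ⟨⟨⟨h1, h2⟩, h3⟩, h4⟩ := hc hx
      have := h.pos x h1 h4
      have h6 : s.eval x / p.eval x - M ≤ 0 := by linarith [le_abs_self (s.eval x / p.eval x)]
      exact mul_nonpos_of_nonpos_of_nonneg (mul_nonpos_of_nonpos_of_nonneg h6 this.le)
        (Real.exp_pos _).le
  have hlim : Tendsto (fun x => w x * Real.exp (-M * x)) (𝓝[>] a) (𝓝 0) := by
    have h1 := h.left_end
    rw [atLeftEnd_coe] at h1
    have h2 : Tendsto (fun x => Real.exp (-M * x) / p.eval x) (𝓝[>] a)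
        (𝓝 (Real.exp (-M * a) / p.eval a)) := by
      have : ContinuousAt (fun x => Real.exp (-M * x) / p.eval x) a :=
        ContinuousAt.div (by fun_prop) p.continuousAt hpa
      exact this.mono_left nhdsWithin_le_nhds
    have h3 := h1.mul h2
    rw [zero_mul] at h3
    refine h3.congr' ?_
    filter_upwards [eventually_eval_ne_zero hle h.p_ne_zero] with x hx
    field_simp
  obtain ⟨x₀, hx₀⟩ := exists_between hac'
  obtain ⟨⟨⟨h1, h2⟩, h3⟩, h4⟩ := hc hx₀
  have hpos : 0 < w x₀ * Real.exp (-M * x₀) := mul_pos (h.pos x₀ h1 h4) (Real.exp_pos _)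
  have := ge_of_tendsto hlim (b := w x₀ * Real.exp (-M * x₀)) (by
    filter_upwards [Ioo_mem_nhdsGT hx₀.1] with x hx
    exact hanti ⟨hx.1, hx.2.trans hx₀.2⟩ hx₀ hx.2.le)
  linarith

theorem IsPearson.eval_right_eq_zero {b : ℝ} (h : IsPearson p s Z a b w) : p.eval b = 0 := by
  have h1 := h.reflect
  rw [← EReal.coe_neg] at h1
  simpa [eval_comp] using h1.eval_left_eq_zero

/-- If all moments up to infinity are finite, then `s / p` is large and negative. -/
theorem IsPearson.degree_le_of_top (h : IsPearson p s Z a ⊤ w) :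
    p.degree ≤ s.degree ∧ s.leadingCoeff / p.leadingCoeff < 0 := by
  by_contra hneg
  -- If the conclusion fails, `x s / p` is either bounded or tends to `+∞`. In both cases `x ^ (κ +
  -- 1) w` is eventually nondecreasing and positive, so that moment diverges.
  have hκ : ∃ κ : ℕ, ∀ᶠ x in atTop, -(κ : ℝ) ≤ x * (s.eval x / p.eval x) := by
    by_cases hdeg : (X * s).degree ≤ p.degree
    · obtain ⟨c, hc⟩ := (isBigO_atTop_of_degree_le (X * s) p hdeg).bound
      obtain ⟨κ, hκ⟩ := exists_nat_ge c
      refine ⟨κ, ?_⟩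
      filter_upwards [hc, eventually_eval_ne_zero atTop_le_cofinite h.p_ne_zero] with x hx hpx
      rw [eval_mul, eval_X, Real.norm_eq_abs, Real.norm_eq_abs] at hx
      have h1 : |x * (s.eval x / p.eval x)| ≤ c := by
        rw [← mul_div_assoc, abs_div, div_le_iff₀ (abs_pos.2 hpx)]; exact hx
      have := neg_abs_le (x * (s.eval x / p.eval x))
      linarith
    · have hs : s ≠ 0 := by rintro rfl; simp at hdeg
      have hlt : p.degree < (X * s).degree := not_le.1 hdeg
      have hle : p.degree ≤ s.degree := by
        rw [degree_mul, degree_X, degree_eq_natDegree hs, degree_eq_natDegree h.p_ne_zero] at hlt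
        rw [degree_eq_natDegree hs, degree_eq_natDegree h.p_ne_zero]
        norm_cast at hlt ⊢
        omega
      have hlead : 0 ≤ (X * s).leadingCoeff / p.leadingCoeff := by
        rw [leadingCoeff_mul, leadingCoeff_X, one_mul]
        by_contra hc
        exact hneg ⟨hle, not_le.1 hc⟩
      refine ⟨0, ?_⟩
      filter_upwards [(div_tendsto_atTop_of_degree_gt (X * s) p hlt h.p_ne_zero
        hlead).eventually_ge_atTop 0] with x hx
      rw [eval_mul, eval_X] at hx
      rw [← mul_div_assoc]
      simpa using hx
  obtain ⟨κ, hκ⟩ := hκ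
  have hI : ∀ᶠ x : ℝ in atTop, x ∈ interval a ⊤ := by
    obtain ⟨x₀, hx₀⟩ := interval_nonempty h.lt
    filter_upwards [eventually_ge_atTop x₀] with x hx
    exact ⟨hx₀.1.trans_le (by exact_mod_cast hx), EReal.coe_lt_top x⟩
  obtain ⟨M, hM⟩ := eventually_atTop.1 ((((hI.and hκ).and
    (eventually_eval_ne_zero atTop_le_cofinite h.p_ne_zero)).and
    (eventually_eval_ne_zero atTop_le_cofinite h.Z_ne_zero)).and (eventually_gt_atTop (0 : ℝ)))
  have hder : ∀ x ∈ Set.Ici M, HasDerivAt (fun x => x ^ (κ + 1) * w x)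
      (x ^ κ * w x * ((κ + 1 : ℕ) + x * (s.eval x / p.eval x))) x := by
    intro x hx
    obtain ⟨⟨⟨⟨h1, h2⟩, h3⟩, h4⟩, h5⟩ := hM x hx
    refine ((hasDerivAt_pow (κ + 1) x).fun_mul
      (hasDerivAt_of_pearson h3 (h.deriv x h1))).congr_deriv ?_
    simp only [Nat.add_sub_cancel]
    ring
  have hmono : MonotoneOn (fun x => x ^ (κ + 1) * w x) (Set.Ici M) := by
    refine monotoneOn_of_deriv_nonneg (convex_Ici M)
      (fun x hx => (hder x hx).continuousAt.continuousWithinAt) ?_ ?_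
    · exact fun x hx => (hder x (interior_subset hx)).differentiableAt.differentiableWithinAt
    · intro x hx
      have hx := interior_subset hx
      rw [(hder x hx).deriv]
      obtain ⟨⟨⟨⟨h1, h2⟩, h3⟩, h4⟩, h5⟩ := hM x hx
      have := h.pos x h1 h4
      push_cast
      exact mul_nonneg (by positivity) (by linarith)
  obtain ⟨⟨⟨⟨h1, h2⟩, h3⟩, h4⟩, h5⟩ := hM M le_rfl
  have hpos : 0 < M ^ (κ + 1) * w M := mul_pos (pow_pos h5 _) (h.pos M h1 h4)
  have hint : IntegrableOn (fun _ : ℝ => M ^ (κ + 1) * w M) (Set.Ici M) := by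
    refine ((h.moments (κ + 1)).mono_set fun x hx => (hM x hx).1.1.1.1).mono'
      aestronglyMeasurable_const ?_
    refine (ae_restrict_iff' measurableSet_Ici).2 (Eventually.of_forall fun x hx => ?_)
    rw [Real.norm_of_nonneg hpos.le]
    exact hmono (Set.mem_Ici.2 le_rfl) hx hx
  rw [integrableOn_const_iff] at hint
  rcases hint with hint | hint
  · exact hpos.ne' (by simpa using hint)
  · simp at hint

end Pearson

/-! ### Integration of the Pearson equation and the classical weights. -/

section Classical

variable {p s Z : ℝ[X]} {a b : EReal} {w : ℝ → ℝ}

/-- Positive solutions of a first-order linear equation are proportional. -/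
theorem exists_eq_const_mul {I : Set ℝ} (ho : IsOpen I) (hc : Convex ℝ I) (hne : I.Nonempty)
    {w g r : ℝ → ℝ} (hw : ∀ x ∈ I, HasDerivAt w (r x * w x) x) (hw0 : ∀ x ∈ I, 0 < w x)
    (hg : ∀ x ∈ I, HasDerivAt g (r x * g x) x) (hg0 : ∀ x ∈ I, 0 < g x) :
    ∃ c : ℝ, 0 < c ∧ ∀ x ∈ I, w x = c * g x := by
  have hd : ∀ x ∈ I, HasDerivAt (fun x => w x / g x) 0 x := by
    intro x hx
    refine ((hw x hx).fun_div (hg x hx) (hg0 x hx).ne').congr_deriv ?_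
    rw [div_eq_zero_iff]
    left; ring
  obtain ⟨c, hc⟩ := ho.exists_is_const_of_deriv_eq_zero hc.isPreconnected
    (fun x hx => (hd x hx).differentiableAt.differentiableWithinAt) (fun x hx => (hd x hx).deriv)
  obtain ⟨x₀, hx₀⟩ := hne
  refine ⟨c, ?_, fun x hx => ?_⟩
  · rw [← hc x₀ hx₀]; exact div_pos (hw0 _ hx₀) (hg0 _ hx₀)
  · rw [← hc x hx, div_mul_cancel₀ _ (hg0 x hx).ne']

/-- A boundary condition `t ^ (α + 1) → 0` as `t → 0` bounds the exponent. -/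
theorem neg_one_lt_of_tendsto {l : Filter ℝ} [l.NeBot] {t h : ℝ → ℝ} {α h₀ : ℝ}
    (ht : Tendsto t l (𝓝[>] 0)) (hh : Tendsto h l (𝓝 h₀)) (hh₀ : h₀ ≠ 0)
    (hlim : Tendsto (fun x => t x ^ (α + 1) * h x) l (𝓝 0)) : -1 < α := by
  by_contra hα
  have h1 := hlim.div hh hh₀
  rw [zero_div] at h1
  have h2 : ∀ᶠ x in l, 1 ≤ t x ^ (α + 1) * h x / h x := by
    filter_upwards [ht.eventually (Ioo_mem_nhdsGT one_pos), hh.eventually_ne hh₀] with x hx hx'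
    rw [mul_div_assoc, div_self hx', mul_one]
    exact Real.one_le_rpow_of_pos_of_le_one_of_nonpos hx.1 hx.2.le (by linarith)
  have := ge_of_tendsto h1 h2
  linarith

theorem IsClassicalWeight.of_reflect
    (h : IsClassicalWeight (interval (-b) (-a)) (fun x => w (-x))) :
    IsClassicalWeight (interval a b) w := by
  have hmem : ∀ x, x ∈ interval a b ↔ -x ∈ interval (-b) (-a) := by
    intro x; rw [← neg_mem_interval, neg_neg]
  obtain ⟨c, μ, ν, hc, hμ, h⟩ := h
  refine ⟨c, -μ, ν, hc, neg_ne_zero.2 hμ, ?_⟩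
  rcases h with ⟨hI, h⟩ | ⟨α, hα, hI, h⟩ | ⟨α, β, hα, hβ, hI, h⟩
  · refine Or.inl ⟨?_, fun x hx => ?_⟩
    · ext x; simp [hmem, hI]
    · have := h (-x) ((hmem x).1 hx)
      simpa using this
  · refine Or.inr (Or.inl ⟨α, hα, ?_, fun x hx => ?_⟩)
    · ext x; simp [hmem, hI]
    · have := h (-x) ((hmem x).1 hx)
      simpa using this
  · refine Or.inr (Or.inr ⟨α, β, hα, hβ, ?_, fun x hx => ?_⟩)
    · ext x; simp [hmem, hI]
    · have := h (-x) ((hmem x).1 hx)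
      simpa using this

theorem eq_C_mul_add_C_mul_of_natDegree_le_one (hs : s.natDegree ≤ 1) (x y : ℝ) :
    s.eval x = s.coeff 1 * (x - y) + s.eval y := by
  rw [eq_X_add_C_of_natDegree_le_one hs]
  simp; ring

/-- The coefficients of a Pearson equation on a half-line. -/
theorem IsPearson.half_line {a : ℝ} (h : IsPearson p s Z a ⊤ w) (hs : s.natDegree ≤ 1) :
    ∃ k, k ≠ 0 ∧ s.coeff 1 / k < 0 ∧ ∀ x, p.eval x = k * (x - a) := by
  obtain ⟨hle, hneg⟩ := h.degree_le_of_top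
  obtain ⟨q, hq⟩ := dvd_iff_isRoot.2 h.eval_left_eq_zero
  have hp0 := h.p_ne_zero
  have hq0 : q ≠ 0 := by rintro rfl; simp at hq; exact hp0 hq
  have hs0 : s ≠ 0 := by rintro rfl; simp at hneg
  have hpd : p.natDegree = 1 + q.natDegree := by
    rw [hq, natDegree_mul (X_sub_C_ne_zero a) hq0, natDegree_X_sub_C]
  have hle' := natDegree_le_natDegree hle
  have hqC := eq_C_of_natDegree_eq_zero (p := q) (by omega)
  have hsd : s.natDegree = 1 := by omega
  refine ⟨q.coeff 0, ?_, ?_, ?_⟩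
  · intro h0; rw [h0] at hqC; simp at hqC; exact hq0 hqC
  · rw [leadingCoeff, hsd, hq, leadingCoeff_mul, leadingCoeff_X_sub_C, one_mul, hqC,
      leadingCoeff_C] at hneg
    exact hneg
  · intro x
    rw [hq, hqC]; simp [mul_comm]

theorem IsPearson.bounded {a b : ℝ} (h : IsPearson p s Z a b w) (hp : p.natDegree ≤ 2) :
    ∃ k, k ≠ 0 ∧ ∀ x, p.eval x = k * ((x - a) * (x - b)) := by
  have hab : a < b := by exact_mod_cast h.lt
  have hp0 := h.p_ne_zero
  obtain ⟨q, hq⟩ := dvd_iff_isRoot.2 h.eval_left_eq_zero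
  have hqb : q.IsRoot b := by
    have := h.eval_right_eq_zero
    rw [hq, eval_mul, mul_eq_zero] at this
    refine this.resolve_left ?_
    simp [sub_ne_zero.2 hab.ne']
  obtain ⟨q', rfl⟩ := dvd_iff_isRoot.2 hqb
  have hq0 : q' ≠ 0 := by rintro rfl; simp at hq; exact hp0 hq
  have hpd : p.natDegree = 1 + (1 + q'.natDegree) := by
    rw [hq, natDegree_mul (X_sub_C_ne_zero a) (mul_ne_zero (X_sub_C_ne_zero b) hq0),
      natDegree_mul (X_sub_C_ne_zero b) hq0, natDegree_X_sub_C, natDegree_X_sub_C]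
  have hqC := eq_C_of_natDegree_eq_zero (p := q') (by omega)
  refine ⟨q'.coeff 0, ?_, ?_⟩
  · intro h0; rw [h0] at hqC; simp at hqC; exact hq0 hqC
  · intro x
    rw [hq, hqC]; simp; ring

/-- Decay at both ends excludes `deg s = deg p`: reflection would then reverse the sign of the ratio
of leading coefficients. Only degrees one and zero remain. -/
theorem IsPearson.line (h : IsPearson p s Z ⊥ ⊤ w) (hs : s.natDegree ≤ 1) :
    ∃ k, k ≠ 0 ∧ s.coeff 1 / k < 0 ∧ ∀ x, p.eval x = k := by
  obtain ⟨hle, hneg⟩ := h.degree_le_of_top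
  have hr := h.reflect
  rw [EReal.neg_bot] at hr
  obtain ⟨-, hneg'⟩ := hr.degree_le_of_top
  have hX : (-X : ℝ[X]).natDegree ≠ 0 := by simp
  rw [leadingCoeff_neg, leadingCoeff_comp hX, leadingCoeff_comp hX, leadingCoeff_neg,
    leadingCoeff_X] at hneg'
  have hle' := natDegree_le_natDegree hle
  have hdeg : s.natDegree = 1 ∧ p.natDegree = 0 := by
    rcases hle'.lt_or_eq with h1 | h1
    · omega
    · exfalso
      rw [h1, neg_div, mul_div_mul_right _ _ (pow_ne_zero _ (by norm_num))] at hneg'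
      linarith
  have hpC := eq_C_of_natDegree_eq_zero hdeg.2
  refine ⟨p.coeff 0, ?_, ?_, ?_⟩
  · intro h0; rw [h0] at hpC; exact h.p_ne_zero (by simpa using hpC)
  · rw [leadingCoeff, hdeg.1, leadingCoeff, hdeg.2] at hneg
    exact hneg
  · intro x; rw [hpC]; simp

/-- Case distinction on the endpoints of an interval, up to reflection. -/
theorem interval_cases {motive : EReal → EReal → Prop} (hbd : ∀ a b : ℝ, motive a b)
    (hright : ∀ a : ℝ, motive a ⊤) (hleft : ∀ b : ℝ, motive ⊥ b) (hline : motive ⊥ ⊤)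
    {a b : EReal} (h : a < b) : motive a b := by
  induction a with
  | bot =>
    induction b with
    | bot => exact absurd h (lt_irrefl _)
    | coe b => exact hleft b
    | top => exact hline
  | coe a =>
    induction b with
    | bot => exact absurd h not_lt_bot
    | coe b => exact hbd a b
    | top => exact hright a
  | top => exact absurd h not_top_lt

theorem IsPearson.eval_ne_zero (h : IsPearson p s Z a b w) (hp : p.natDegree ≤ 2)
    (hs : s.natDegree ≤ 1) : ∀ x ∈ interval a b, p.eval x ≠ 0 := by
  have hright : ∀ (p s Z : ℝ[X]) (w : ℝ → ℝ) (a : ℝ), IsPearson p s Z a ⊤ w →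
      s.natDegree ≤ 1 → ∀ x ∈ interval (a : EReal) ⊤, p.eval x ≠ 0 := by
    intro p s Z w a h hs x hx
    obtain ⟨k, hk, -, he⟩ := h.half_line hs
    rw [he]
    have : a < x := by exact_mod_cast hx.1
    exact mul_ne_zero hk (sub_ne_zero.2 this.ne')
  have hlt := h.lt
  revert h
  refine interval_cases (motive := fun a b => IsPearson p s Z a b w →
    ∀ x ∈ interval a b, p.eval x ≠ 0) ?_ ?_ ?_ ?_ hlt
  · intro a b h x hx
    obtain ⟨k, hk, he⟩ := h.bounded hp
    rw [he]
    have h1 : a < x := by exact_mod_cast hx.1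
    have h2 : x < b := by exact_mod_cast hx.2
    exact mul_ne_zero hk (mul_ne_zero (sub_ne_zero.2 h1.ne') (sub_ne_zero.2 h2.ne))
  · exact fun a h => hright p s Z w a h hs
  · intro b h x hx
    have hr := h.reflect
    rw [EReal.neg_bot, ← EReal.coe_neg] at hr
    have hs' : (-s.comp (-X)).natDegree ≤ 1 := by
      rw [natDegree_neg, natDegree_comp]; simpa using hs
    have := hright _ _ _ _ _ hr hs' (-x) (by
      rw [EReal.coe_neg, ← EReal.neg_bot, ← neg_mem_interval, neg_neg]; exact hx)
    simpa [eval_comp] using this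
  · intro h x _
    obtain ⟨k, hk, -, he⟩ := h.line hs
    rw [he]; exact hk

theorem IsPearson.isClassicalWeight_line (h : IsPearson p s Z ⊥ ⊤ w)
    (hpos : ∀ x ∈ interval ⊥ ⊤, 0 < w x) (hs : s.natDegree ≤ 1) :
    IsClassicalWeight (interval ⊥ ⊤) w := by
  obtain ⟨k, hk, hneg, he⟩ := h.line hs
  set β := s.coeff 1 / k with hβ
  -- Here `s / p = β x + γ` with `β < 0`; completing the square gives the scale `μ` and the shift
  -- `-γ / (2 μ)`.
  set γ := s.eval 0 / k with hγ
  set μ := Real.sqrt (-β / 2) with hμ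
  have hμ2 : μ ^ 2 = -β / 2 := Real.sq_sqrt (by linarith)
  have hμ0 : μ ≠ 0 := (Real.sqrt_pos.2 (by linarith)).ne'
  have hse : ∀ x, s.eval x = k * (β * x + γ) := by
    intro x
    rw [eq_C_mul_add_C_mul_of_natDegree_le_one hs x 0, hβ, hγ]
    field_simp
    ring
  obtain ⟨c, hc, hwc⟩ := exists_eq_const_mul (isOpen_interval ⊥ ⊤) (convex_interval ⊥ ⊤)
    (interval_nonempty h.lt) (w := w) (r := fun x => β * x + γ)
    (g := fun x => Real.exp (-(μ * x + -γ / (2 * μ)) ^ 2)) (fun x hx => by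
      have := hasDerivAt_of_pearson (by rw [he]; exact hk) (h.deriv x hx)
      rwa [he, hse, mul_div_cancel_left₀ _ hk] at this) hpos (fun x hx => by
      have h1 : HasDerivAt (fun x : ℝ => μ * x + -γ / (2 * μ)) μ x := by
        simpa using ((hasDerivAt_id x).const_mul μ).add_const (-γ / (2 * μ))
      refine (h1.fun_pow 2).fun_neg.exp.congr_deriv ?_
      rw [mul_comm]
      congr 1
      have : β = -2 * μ ^ 2 := by linarith
      rw [this]
      push_cast
      field_simp
      ring) (fun x _ => Real.exp_pos _)
  refine ⟨c, μ, -γ / (2 * μ), hc, hμ0, Or.inl ⟨?_, hwc⟩⟩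
  ext x
  simp [interval]

theorem IsPearson.isClassicalWeight_half_line {a : ℝ} (h : IsPearson p s Z a ⊤ w)
    (hpos : ∀ x ∈ interval a ⊤, 0 < w x) (hs : s.natDegree ≤ 1) :
    IsClassicalWeight (interval a ⊤) w := by
  obtain ⟨k, hk, hneg, he⟩ := h.half_line hs
  set β := s.coeff 1 / k with hβ
  set α := s.eval a / k with hα
  have hse : ∀ x, s.eval x = k * (β * (x - a) + α) := by
    intro x
    rw [eq_C_mul_add_C_mul_of_natDegree_le_one hs x a, hβ, hα]
    field_simp
  have hI : ∀ x : ℝ, x ∈ interval (a : EReal) ⊤ ↔ a < x := by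
    intro x; simp [interval]
  -- The Laguerre variable is `t = -β (x - a)`, since `s / p = β + α / (x - a)`.
  have ht : ∀ x, -β * x + β * a = -β * (x - a) := fun x => by ring
  have htpos : ∀ x, 0 < -β * x + β * a ↔ a < x := by
    intro x
    rw [ht, mul_pos_iff_of_pos_left (by linarith), sub_pos]
  obtain ⟨c, hc, hwc⟩ := exists_eq_const_mul (isOpen_interval a ⊤) (convex_interval a ⊤)
    (interval_nonempty h.lt) (w := w) (r := fun x => β + α / (x - a))
    (g := fun x => (-β * x + β * a) ^ α * Real.exp (-(-β * x + β * a))) (fun x hx => by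
      have hxa : x - a ≠ 0 := sub_ne_zero.2 ((hI x).1 hx).ne'
      have := hasDerivAt_of_pearson (by rw [he]; exact mul_ne_zero hk hxa) (h.deriv x hx)
      rw [he, hse, mul_div_mul_left _ _ hk] at this
      refine this.congr_deriv ?_
      field_simp) hpos (fun x hx => by
      have hxa : x - a ≠ 0 := sub_ne_zero.2 ((hI x).1 hx).ne'
      have hx0 := (htpos x).2 ((hI x).1 hx)
      have h1 : HasDerivAt (fun x : ℝ => -β * x + β * a) (-β) x := by
        simpa using ((hasDerivAt_id x).const_mul (-β)).add_const (β * a)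
      refine ((h1.rpow_const (p := α) (Or.inl hx0.ne')).fun_mul h1.fun_neg.exp).congr_deriv ?_
      rw [Real.rpow_sub_one hx0.ne', ht]
      have : β ≠ 0 := hneg.ne
      field_simp
      ring) (fun x hx => mul_pos (Real.rpow_pos_of_pos ((htpos x).2 ((hI x).1 hx)) _)
        (Real.exp_pos _))
  refine ⟨c, -β, β * a, hc, neg_ne_zero.2 hneg.ne,
    Or.inr (Or.inl ⟨α, ?_, ?_, hwc⟩)⟩
  · have hle := h.left_end
    rw [atLeftEnd_coe] at hle
    -- Near `a` the boundary term `p w` is `t ^ (α + 1)` times a factor with nonzero limit.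
    refine neg_one_lt_of_tendsto (l := 𝓝[>] a) (t := fun x => -β * x + β * a)
      (h := fun x => k * c / -β * Real.exp (-(-β * x + β * a)))
      (h₀ := k * c / -β * Real.exp (-(-β * a + β * a))) ?_ ?_ ?_ ?_
    · refine tendsto_nhdsWithin_iff.2 ⟨?_, ?_⟩
      · have : ContinuousAt (fun x : ℝ => -β * x + β * a) a := by fun_prop
        have h2 := this.tendsto.mono_left (nhdsWithin_le_nhds (s := Set.Ioi a))
        simpa using h2
      · filter_upwards [self_mem_nhdsWithin] with x hx
        exact (htpos x).2 hx
    · have : ContinuousAt (fun x : ℝ => k * c / -β * Real.exp (-(-β * x + β * a))) a := by fun_prop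
      exact this.tendsto.mono_left nhdsWithin_le_nhds
    · exact mul_ne_zero (div_ne_zero (mul_ne_zero hk hc.ne') (neg_ne_zero.2 hneg.ne))
        (Real.exp_pos _).ne'
    · refine hle.congr' ?_
      filter_upwards [self_mem_nhdsWithin] with x hx
      have hx0 := (htpos x).2 hx
      rw [hwc x ((hI x).2 hx), he, Real.rpow_add_one hx0.ne']
      have : β ≠ 0 := hneg.ne
      field_simp
      ring
  · ext x
    rw [hI, ← htpos]
    rfl

theorem IsPearson.isClassicalWeight_bounded {a b : ℝ} (h : IsPearson p s Z a b w)
    (hpos : ∀ x ∈ interval a b, 0 < w x) (hp : p.natDegree ≤ 2) (hs : s.natDegree ≤ 1) :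
    IsClassicalWeight (interval a b) w := by
  obtain ⟨k, hk, he⟩ := h.bounded hp
  have hab : a < b := by exact_mod_cast h.lt
  have hba : b - a ≠ 0 := (sub_pos.2 hab).ne'
  -- `A` and `B` are the residues in `s / p = A / (x - a) + B / (x - b)`, and become the exponents
  -- at `a` and `b`.
  set A := -s.eval a / (k * (b - a)) with hA
  set B := s.eval b / (k * (b - a)) with hB
  have hse : ∀ x, s.eval x = k * (A * (x - b) + B * (x - a)) := by
    intro x
    have h1 := eq_C_mul_add_C_mul_of_natDegree_le_one hs x a
    have h2 := eq_C_mul_add_C_mul_of_natDegree_le_one hs b a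
    rw [hA, hB]
    field_simp
    linear_combination (b - a) * h1 - (x - a) * h2
  set μ := 2 / (b - a) with hμ
  set ν := -(a + b) / (b - a) with hν
  have hμ0 : 0 < μ := div_pos two_pos (sub_pos.2 hab)
  have h1t : ∀ x, 1 + (μ * x + ν) = μ * (x - a) := by
    intro x; rw [hμ, hν]; field_simp; ring
  have h2t : ∀ x, 1 - (μ * x + ν) = μ * (b - x) := by
    intro x; rw [hμ, hν]; field_simp; ring
  have hI : ∀ x : ℝ, x ∈ interval (a : EReal) b ↔ a < x ∧ x < b := by
    intro x; simp [interval]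
  have h1p : ∀ x, 0 < 1 + (μ * x + ν) ↔ a < x := by
    intro x; rw [h1t, mul_pos_iff_of_pos_left hμ0, sub_pos]
  have h2p : ∀ x, 0 < 1 - (μ * x + ν) ↔ x < b := by
    intro x; rw [h2t, mul_pos_iff_of_pos_left hμ0, sub_pos]
  have hμd : ∀ x : ℝ, HasDerivAt (fun x : ℝ => μ * x + ν) μ x := by
    intro x
    simpa using ((hasDerivAt_id x).const_mul μ).add_const ν
  obtain ⟨c, hc, hwc⟩ := exists_eq_const_mul (isOpen_interval a b) (convex_interval a b)
    (interval_nonempty h.lt) (w := w) (r := fun x => A / (x - a) - B / (b - x))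
    (g := fun x => (1 - (μ * x + ν)) ^ B * (1 + (μ * x + ν)) ^ A) (fun x hx => by
      obtain ⟨hxa, hxb⟩ := (hI x).1 hx
      have hxa' : x - a ≠ 0 := sub_ne_zero.2 hxa.ne'
      have hxb' : b - x ≠ 0 := sub_ne_zero.2 hxb.ne'
      have hxb2 : x - b ≠ 0 := sub_ne_zero.2 hxb.ne
      have := hasDerivAt_of_pearson (by rw [he]; exact mul_ne_zero hk (mul_ne_zero hxa' hxb2))
        (h.deriv x hx)
      rw [he, hse, mul_div_mul_left _ _ hk] at this
      refine this.congr_deriv ?_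
      congr 1
      rw [← neg_sub b x] at hxb2 ⊢
      field_simp
      ring) hpos (fun x hx => by
      obtain ⟨hxa, hxb⟩ := (hI x).1 hx
      have hxa' : x - a ≠ 0 := sub_ne_zero.2 hxa.ne'
      have hxb' : b - x ≠ 0 := sub_ne_zero.2 hxb.ne'
      have hp1 := (h1p x).2 hxa
      have hp2 := (h2p x).2 hxb
      refine ((((hμd x).const_sub 1).rpow_const (p := B) (Or.inl hp2.ne')).fun_mul
        (((hμd x).const_add 1).rpow_const (p := A) (Or.inl hp1.ne'))).congr_deriv ?_
      rw [Real.rpow_sub_one hp1.ne', Real.rpow_sub_one hp2.ne', h1t, h2t]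
      have := hμ0.ne'
      field_simp
      ring) (fun x hx => mul_pos (Real.rpow_pos_of_pos ((h2p x).2 ((hI x).1 hx).2) _)
        (Real.rpow_pos_of_pos ((h1p x).2 ((hI x).1 hx).1) _))
  have hpt : ∀ x, p.eval x = -k / μ ^ 2 * ((1 + (μ * x + ν)) * (1 - (μ * x + ν))) := by
    intro x
    rw [h1t, h2t, he]
    have := hμ0.ne'
    field_simp
    ring
  have hk' : -k / μ ^ 2 ≠ 0 := div_ne_zero (neg_ne_zero.2 hk) (pow_ne_zero 2 hμ0.ne')
  refine ⟨c, μ, ν, hc, hμ0.ne', Or.inr (Or.inr ⟨B, A, ?_, ?_, ?_, hwc⟩)⟩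
  · have hle := h.right_end
    rw [atRightEnd_coe] at hle
    refine neg_one_lt_of_tendsto (l := 𝓝[<] b) (t := fun x => 1 - (μ * x + ν))
      (h := fun x => -k / μ ^ 2 * c * (1 + (μ * x + ν)) ^ (A + 1))
      (h₀ := -k / μ ^ 2 * c * (1 + (μ * b + ν)) ^ (A + 1)) ?_ ?_ ?_ ?_
    · refine tendsto_nhdsWithin_iff.2 ⟨?_, ?_⟩
      · have : ContinuousAt (fun x : ℝ => 1 - (μ * x + ν)) b := by fun_prop
        have h2 := this.tendsto.mono_left (nhdsWithin_le_nhds (s := Set.Iio b))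
        simpa [h2t] using h2
      · filter_upwards [self_mem_nhdsWithin] with x hx
        exact (h2p x).2 hx
    · have : ContinuousAt (fun x : ℝ => -k / μ ^ 2 * c * (1 + (μ * x + ν)) ^ (A + 1)) b :=
        continuousAt_const.mul (ContinuousAt.rpow_const (by fun_prop)
          (Or.inl ((h1p b).2 hab).ne'))
      exact this.tendsto.mono_left nhdsWithin_le_nhds
    · exact mul_ne_zero (mul_ne_zero hk' hc.ne') (Real.rpow_pos_of_pos ((h1p b).2 hab) _).ne'
    · refine hle.congr' ?_
      filter_upwards [Ioo_mem_nhdsLT hab] with x hx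
      rw [hwc x ((hI x).2 hx), hpt, Real.rpow_add_one ((h1p x).2 hx.1).ne',
        Real.rpow_add_one ((h2p x).2 hx.2).ne']
      ring
  · have hle := h.left_end
    rw [atLeftEnd_coe] at hle
    refine neg_one_lt_of_tendsto (l := 𝓝[>] a) (t := fun x => 1 + (μ * x + ν))
      (h := fun x => -k / μ ^ 2 * c * (1 - (μ * x + ν)) ^ (B + 1))
      (h₀ := -k / μ ^ 2 * c * (1 - (μ * a + ν)) ^ (B + 1)) ?_ ?_ ?_ ?_
    · refine tendsto_nhdsWithin_iff.2 ⟨?_, ?_⟩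
      · have : ContinuousAt (fun x : ℝ => 1 + (μ * x + ν)) a := by fun_prop
        have h2 := this.tendsto.mono_left (nhdsWithin_le_nhds (s := Set.Ioi a))
        simpa [h1t] using h2
      · filter_upwards [self_mem_nhdsWithin] with x hx
        exact (h1p x).2 hx
    · have : ContinuousAt (fun x : ℝ => -k / μ ^ 2 * c * (1 - (μ * x + ν)) ^ (B + 1)) a :=
        continuousAt_const.mul (ContinuousAt.rpow_const (by fun_prop)
          (Or.inl ((h2p a).2 hab).ne'))
      exact this.tendsto.mono_left nhdsWithin_le_nhds
    · exact mul_ne_zero (mul_ne_zero hk' hc.ne') (Real.rpow_pos_of_pos ((h2p a).2 hab) _).ne'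
    · refine hle.congr' ?_
      filter_upwards [Ioo_mem_nhdsGT hab] with x hx
      rw [hwc x ((hI x).2 hx), hpt, Real.rpow_add_one ((h1p x).2 hx.1).ne',
        Real.rpow_add_one ((h2p x).2 hx.2).ne']
      ring
  · ext x
    rw [hI, ← h1p, ← h2p]
    simp only [Set.mem_ofPred_eq, sub_pos, neg_lt_iff_pos_add']

theorem IsPearson.isClassicalWeight (h : IsPearson p s Z a b w)
    (hpos : ∀ x ∈ interval a b, 0 < w x) (hp : p.natDegree ≤ 2) (hs : s.natDegree ≤ 1) :
    IsClassicalWeight (interval a b) w := by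
  have hlt := h.lt
  revert h hpos
  refine interval_cases (motive := fun a b => IsPearson p s Z a b w →
    (∀ x ∈ interval a b, 0 < w x) → IsClassicalWeight (interval a b) w) ?_ ?_ ?_ ?_ hlt
  · exact fun a b h hpos => h.isClassicalWeight_bounded hpos hp hs
  · exact fun a h hpos => h.isClassicalWeight_half_line hpos hs
  · intro b h hpos
    have hr := h.reflect
    have hs' : (-s.comp (-X)).natDegree ≤ 1 := by
      rw [natDegree_neg, natDegree_comp]; simpa using hs
    apply IsClassicalWeight.of_reflect
    rw [EReal.neg_bot, ← EReal.coe_neg] at hr ⊢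
    refine hr.isClassicalWeight_half_line (fun x hx => hpos _ ?_) hs'
    rwa [neg_mem_interval, EReal.neg_bot, ← EReal.coe_neg]
  · exact fun h hpos => h.isClassicalWeight_line hpos hs

end Classical

/-! ### Zeros of `η` and assembly of the theorem. -/

theorem eval_ne_zero_of_identity {N δ p s η : ℝ[X]} (hη : η ≠ 0)
    (hid : N * p * η = δ * (s * η - 2 * p * derivative η)) {x : ℝ} (hδ : δ.eval x ≠ 0)
    (hp : p.eval x ≠ 0) : η.eval x ≠ 0 := by
  obtain ⟨n, u, rfl, hu⟩ := exists_eq_pow_mul_eval_ne_zero hη x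
  rcases n with _ | n
  · simpa using hu
  exfalso
  have h1 := X_sub_C_mul_derivative_pow_mul x (n + 1) u
  -- At a zero of order `n + 1`, the pole of `2 η' / η` is unmatched: evaluation at `x` leaves `-2
  -- (n + 1) δ p u = 0`.
  have h2 : (X - C x) * (N * p * u) = δ * ((X - C x) * (s * u) -
      2 * p * (C ((n + 1 : ℕ) : ℝ) * u + (X - C x) * derivative u)) := by
    refine mul_left_cancel₀ (pow_ne_zero (n + 1) (X_sub_C_ne_zero x)) ?_
    linear_combination (X - C x) * hid - 2 * p * δ * h1
  have h3 := congrArg (eval x) h2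
  simp [hδ, hp, hu] at h3
  have : (0 : ℝ) ≤ n := Nat.cast_nonneg n
  linarith

/-- Multiplication by `η²` cancels the term `-2 η' / η` of `W' / W`. Positivity is claimed only off
the zeros of `η`, which are excluded from `I` only after the constraints on `p` are known. -/
theorem IsSLOPS.isPearson {K : Finset ℕ} {y : ℕ → ℝ[X]} {T : DiffOp₂} {a b : EReal}
    {W : ℝ → ℝ} (h : IsSLOPS K y T a b W) {p s η : ℝ[X]} (hp0 : p ≠ 0) (hη : η ≠ 0)
    (hp : T.p = algebraMap ℝ[X] (RatFunc ℝ) p)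
    (hid : T.weightLogDeriv.num * p * η =
      T.weightLogDeriv.denom * (s * η - 2 * p * derivative η)) :
    IsPearson p s η a b (fun x => W x * η.eval x ^ 2) where
  lt := h.lt
  p_ne_zero := hp0
  Z_ne_zero := hη
  deriv := fun x hx => by
    obtain ⟨hpos, d, hd, hd'⟩ := h.weight x hx
    have hδ := denom_eval_ne_zero h.weight hx
    refine ⟨_, hd.fun_mul ((η.hasDerivAt x).fun_pow 2), ?_⟩
    have he := congrArg (eval x) hid
    simp only [eval_mul, eval_sub, eval_ofNat] at he
    refine mul_left_cancel₀ hδ ?_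
    simp only [Nat.cast_ofNat, Nat.add_one_sub_one, pow_one]
    linear_combination (p.eval x * η.eval x ^ 2) * hd' + (W x * η.eval x) * he
  pos := fun x hx hZ => mul_pos (h.weight x hx).1 (by positivity)
  moments := fun j => by
    have key : ∀ f : ℝ[X], IntegrableOn (fun x => f.eval x * W x) (interval a b) := by
      intro f
      have : (fun x => f.eval x * W x) =
          fun x => ∑ i ∈ Finset.range (f.natDegree + 1), f.coeff i * (x ^ i * W x) := by
        funext x
        rw [eval_eq_sum_range, Finset.sum_mul]
        exact Finset.sum_congr rfl fun i _ => by ring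
      rw [this]
      exact integrable_finsetSum _ fun i _ => (h.moments i).const_mul _
    refine (key (X ^ j * η ^ 2)).congr_fun (fun x _ => ?_) (isOpen_interval a b).measurableSet
    simp; ring
  left_end := by
    have := h.left_end (η ^ 2)
    refine this.congr fun x => ?_
    rw [hp, RatFunc.eval_algebraMap]
    simp; ring
  right_end := by
    have := h.right_end (η ^ 2)
    refine this.congr fun x => ?_
    rw [hp, RatFunc.eval_algebraMap]
    simp; ring

end SLOPS

theorem mainTheorem7 (K : Finset ℕ) (y : ℕ → ℝ[X]) (T : SLOPS.DiffOp₂) (a b : EReal)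
    (W : ℝ → ℝ) (h : SLOPS.IsSLOPS K y T a b W) :
    ∃ (p s η : ℝ[X]) (WB : ℝ → ℝ),
      T.p = algebraMap ℝ[X] (RatFunc ℝ) p ∧
      p.natDegree ≤ 2 ∧ s.natDegree ≤ 1 ∧
      η.degree = (K.card : WithBot ℕ) ∧
      SLOPS.IsExpIntegral s p (SLOPS.interval a b) WB ∧
      SLOPS.IsClassicalWeight (SLOPS.interval a b) WB ∧
      ∀ x ∈ SLOPS.interval a b, η.eval x ≠ 0 ∧ W x = WB x / (η.eval x) ^ 2 := by
  obtain ⟨P, Q, R, E, hE, hP, hTp, hTq, hTr⟩ := T.exists_polyOp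
  have happ := SLOPS.DiffOp₂.app_eq_iff hE hTp hTq hTr
  have hE' := RatFunc.algebraMap_ne_zero (K := ℝ) hE
  have heig : ∀ k, k ∉ K → ∃ c : ℝ, E * (C c * y k) = SLOPS.polyOp P Q R (y k) := by
    intro k hk
    obtain ⟨c, hc⟩ := (h.eigen k hk).2
    exact ⟨c, (happ _ _).1 hc⟩
  have hno : ∀ k ∈ K, ∀ (f : ℝ[X]) (c : ℝ), f.degree = k →
      E * (C c * f) ≠ SLOPS.polyOp P Q R f :=
    fun k hk f c hf he => h.no_eigen k hk ⟨f, hf, c, (happ _ _).2 he⟩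
  have hTp' : ∀ p, P = p * E → T.p = algebraMap ℝ[X] (RatFunc ℝ) p := by
    intro p hp
    refine mul_right_cancel₀ hE' ?_
    rw [hTp, hp, map_mul]
  obtain ⟨p, t, η, hPp, hp2, ht1, hηd, hid⟩ := SLOPS.structure_theorem hP hE
    (fun k hk => (h.eigen k hk).1) heig hno (fun p hp f g c hf hg =>
      h.eq_zero_of_jordan hE (hTp' p hp) hTq (hp ▸ hf) (hp ▸ hg))
  have hp := hTp' p hPp
  have hp0 : p ≠ 0 := by rintro rfl; exact hP (by simpa using hPp)
  have hη : η ≠ 0 := by rintro rfl; simp at hηd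
  -- The numerator is `s = t - p'`, the `-p'` coming from the factor `1 / p` in `W`.
  have hs : (t - derivative p).natDegree ≤ 1 :=
    (natDegree_sub_le _ _).trans (max_le ht1 ((natDegree_derivative_le p).trans (by omega)))
  have hw := T.weightLogDeriv_identity hE hp hTq
  have hkey : T.weightLogDeriv.num * p * η =
      T.weightLogDeriv.denom * ((t - derivative p) * η - 2 * p * derivative η) := by
    refine mul_left_cancel₀ hE ?_
    linear_combination -η * hw - T.weightLogDeriv.denom * hid
  have hpear := h.isPearson hp0 hη hp hkey
  have hpI := hpear.eval_ne_zero hp2 hs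
  have hηI : ∀ x ∈ SLOPS.interval a b, η.eval x ≠ 0 := fun x hx =>
    SLOPS.eval_ne_zero_of_identity hη hkey (SLOPS.denom_eval_ne_zero h.weight hx) (hpI x hx)
  have hpos : ∀ x ∈ SLOPS.interval a b, 0 < W x * η.eval x ^ 2 :=
    fun x hx => hpear.pos x hx (hηI x hx)
  refine ⟨p, t - derivative p, η, fun x => W x * η.eval x ^ 2, hp, hp2, hs, hηd,
    ⟨fun x => Real.log (W x * η.eval x ^ 2), fun x hx => ⟨hpI x hx, ?_, ?_⟩⟩,
    hpear.isClassicalWeight hpos hp2 hs, fun x hx => ⟨hηI x hx, ?_⟩⟩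
  · refine ((SLOPS.hasDerivAt_of_pearson (hpI x hx) (hpear.deriv x hx)).log
      (hpos x hx).ne').congr_deriv ?_
    rw [mul_div_cancel_right₀ _ (hpos x hx).ne']
  · exact (Real.exp_log (hpos x hx)).symm
  · rw [mul_div_cancel_right₀ _ (pow_ne_zero 2 (hηI x hx))]

end
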